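/- **Theorem.** Let $k\ge 4$. For an integer $m$ and a simplex $s$, $P_m(s;X)$ denotes the $X$-valued polynomial functions on $s$ of total degree at most $m$ (so $P_m=\{0\}$ for $m<0$), and $(\cdot,\cdot)_s$ is the $L^2$ product on $s$ with respect to length, area or volume. For a nondegenerate tetrahedron $K\subset\mathbb R^3$ with barycentric coordinates $\lambda_1,\dots,\lambda_4$, vertex set $\mathscr V(K)$, edge set $\mathscr E(K)$ and face set $\mathscr F(K)$, let $$\mathring P^{\operatorname{div}}_{k+2}(K;\mathbb R^3)=\{q\in\lambda_1\lambda_2\lambda_3\lambda_4P_{k-2}(K;\mathbb R^3):\ \operatorname{div}q|_f=0\ \text{for all } f\in\mathscr F(K)\}.$$ For every edge $e$ fix a unit tangential vector $t_e$ and two linearly independent normal vectors $n_e^+,n_e^-$. (1) *Unisolvence.* Every $v\in P_{k+2}(K;\mathbb R^3)$ is uniquely determined by the following degrees of freedom: - $v(a),\ \nabla v(a),\ \nabla^2v(a),\ \nabla^2(\operatorname{div}v)(a)$ for all $a\in\mathscr V(K)$; - for all $e\in\mathscr E(K)$: $(v,q)_e$ for $q\in P_{k-4}(e;\mathbb R^3)$;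 $(\operatorname{div}v,q)_e$ for $q\in P_{k-5}(e;\mathbb R)$; $\bigl(\frac{\partial(v\cdot n_e^+)}{\partial n_e^\pm},q\bigr)_e$, $\bigl(\frac{\partial(v\cdot t_e)}{\partial n_e^\pm},q\bigr)_e$, $\bigl(\frac{\partial(v\cdot n_e^-)}{\partial n_e^+},q\bigr)_e$ for $q\in P_{k-3}(e;\mathbb R)$; $\bigl(\frac{\partial(\operatorname{div}v)}{\partial n_e^\pm},q\bigr)_e$ for $q\in P_{k-4}(e;\mathbb R)$; - for all $f\in\mathscr F(K)$: $(v,q)_f$ for $q\in P_{k-4}(f;\mathbb R^3)$; $(\operatorname{div}v,q)_f$ for $q\in P_{k-5}(f;\mathbb R)$; - $(v,q)_K$ for $q\in\mathring P^{\operatorname{div}}_{k+2}(K;\mathbb R^3)$. That is, for every choice of data (arbitrary values at the vertices, subject only to the symmetry of second derivatives, and an arbitrary linear functional on the test space for each family of moments) there is exactly one $v\in P_{k+2}(K;\mathbb R^3)$ with these data. (2) *Conformity.* Let $\mathcal T$ be a finite conforming tetrahedral grid of an open set $\Omega\subset\mathbb R^3$ (a finite pure three-dimensional simplicial complex whose underlying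 space is $\overline\Omega$), with $t_e,n_e^\pm$ fixed for every edge of $\mathcal T$. Let $v_K\in P_{k+2}(K;\mathbb R^3)$, $K\in\mathcal T$, be such that the vertex, edge and face degrees of freedom above are single-valued, i.e. tetrahedra sharing a vertex, edge or face have equal degrees of freedom there. Then $v_K=v_{K'}$ and $\operatorname{div}v_K=\operatorname{div}v_{K'}$ on $K\cap K'$ for all $K,K'\in\mathcal T$. Consequently every piecewise polynomial field $v$ with $v|_K=v_K$ a.e. on each $K\in\mathcal T$ belongs to $$H^1(\operatorname{div},\Omega;\mathbb R^3)=\{v\in H^1(\Omega;\mathbb R^3):\ \operatorname{div}v\in H^1(\Omega;\mathbb R)\}.$$ -/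

import Mathlib

open MeasureTheory MvPolynomial
open scoped ContDiff

noncomputable section

namespace TetElement

/-- Euclidean three-space. -/
abbrev E3 : Type := EuclideanSpace ℝ (Fin 3)

/-- Real polynomials in the three coordinates. -/
abbrev Poly : Type := MvPolynomial (Fin 3) ℝ

/-- Polynomial vector fields `v = (v₁, v₂, v₃)`. -/
abbrev VecPoly : Type := Fin 3 → Poly

/-- The value of a polynomial at a point. -/
def ev (x : E3) (p : Poly) : ℝ := MvPolynomial.eval x.ofLp p

/-! ### Polynomial spaces -/

/-- Polynomials of total degree at most `m`; the zero space when `m < 0`. -/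
def polyLE (m : ℤ) : Submodule ℝ Poly :=
  MvPolynomial.restrictSupport ℝ {s : Fin 3 →₀ ℕ | (s.degree : ℤ) ≤ m}

/-- `P_m(K; ℝ³)` for a tetrahedron `K`: since `K` has interior points, a polynomial function on `K`
is the same thing as a polynomial. -/
def vecPolyLE (m : ℤ) : Submodule ℝ VecPoly := Submodule.pi Set.univ fun _ => polyLE m

/-- The closed simplex with a given finite set of vertices. -/
def hull (s : Finset E3) : Set E3 := convexHull ℝ (s : Set E3)

/-- Restriction of polynomials of degree at most `m` to the simplex with vertex set `s`. -/
def restr (m : ℤ) (s : Finset E3) : polyLE m →ₗ[ℝ] (hull s → ℝ) where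
  toFun p x := ev x p
  map_add' p q := by ext x; simp [ev]
  map_smul' c p := by ext x; simp [ev]

/-- `P_m(s; ℝ)`: the polynomial functions of degree at most `m` on the simplex `s`
(an edge or a face). -/
def PolyOn (m : ℤ) (s : Finset E3) : Submodule ℝ (hull s → ℝ) := LinearMap.range (restr m s)

/-- A polynomial regarded as an element of `P_m(s; ℝ)`. -/
def onto (m : ℤ) (s : Finset E3) : polyLE m →ₗ[ℝ] PolyOn m s := (restr m s).rangeRestrict

/-! ### Differential operators -/

/-- The divergence `∂₁v₁ + ∂₂v₂ + ∂₃v₃`. -/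
def divP (v : VecPoly) : Poly := ∑ i, pderiv i (v i)

/-- The directional derivative `∂q/∂n`. -/
def dirDeriv (n : E3) (q : Poly) : Poly := ∑ j, C (n j) * pderiv j q

/-- The component `v · m`. -/
def dotP (v : VecPoly) (m : E3) : Poly := ∑ i, C (m i) * v i

/-! ### Tetrahedra and their edges, faces and barycentric coordinates -/

/-- The vertex set of a nondegenerate tetrahedron. Its edges and faces are the subsets with two and
with three elements. -/
structure IsTetrahedron (K : Finset E3) : Prop where
  card_eq : K.card = 4
  indep : AffineIndependent ℝ ((↑) : K → E3)

theorem IsTetrahedron.span_eq_top {K : Finset E3} (hK : IsTetrahedron K) :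
    affineSpan ℝ (Set.range ((↑) : K → E3)) = ⊤ := by
  rw [hK.indep.affineSpan_eq_top_iff_card_eq_finrank_add_one]
  simp [hK.card_eq]

/-- The vertices of a tetrahedron as an affine basis; `hK.basis.coord a` is the barycentric
coordinate belonging to the vertex `a`. -/
def IsTetrahedron.basis {K : Finset E3} (hK : IsTetrahedron K) : AffineBasis K ℝ E3 where
  toFun := (↑)
  ind' := hK.indep
  tot' := hK.span_eq_top

/-- A unit tangential vector of an edge and two further vectors. -/
structure EdgeFrame where
  t : E3
  np : E3
  nm : E3

/-- `t` is a unit tangential vector and `np`, `nm` are linearly independent normal vectors of the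
edge `e`. -/
structure EdgeFrame.IsAdapted (F : EdgeFrame) (e : Finset E3) : Prop where
  norm_t : ‖F.t‖ = 1
  tangent : F.t ∈ vectorSpan ℝ (e : Set E3)
  normal_np : F.np ∈ (vectorSpan ℝ (e : Set E3))ᗮ
  normal_nm : F.nm ∈ (vectorSpan ℝ (e : Set E3))ᗮ
  indep : LinearIndependent ℝ ![F.np, F.nm]

/-- The bubble space: the fields `λ₁λ₂λ₃λ₄ p` with `p ∈ P_{k-2}(K; ℝ³)` whose divergence vanishes
on every face of `K`. -/
def divBubble (k : ℕ) {K : Finset E3} (hK : IsTetrahedron K) : Submodule ℝ VecPoly where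
  carrier := {q | (∃ p ∈ vecPolyLE ((k : ℤ) - 2), ∀ x i,
      ev x (q i) = (∏ a : K, hK.basis.coord a x) * ev x (p i)) ∧
    ∀ f ∈ K.powersetCard 3, ∀ x ∈ hull f, ev x (divP q) = 0}
  zero_mem' := ⟨⟨0, Submodule.zero_mem _, by simp [ev]⟩, by simp [ev, divP]⟩
  add_mem' := by
    rintro q q' ⟨⟨p, hp, h⟩, hd⟩ ⟨⟨p', hp', h'⟩, hd'⟩
    refine ⟨⟨p + p', Submodule.add_mem _ hp hp', fun x i => ?_⟩, fun f hf x hx => ?_⟩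
    · have h1 := h x i
      have h2 := h' x i
      simp only [ev, Pi.add_apply, map_add] at h1 h2 ⊢
      rw [h1, h2]; ring
    · have h1 := hd f hf x hx
      have h2 := hd' f hf x hx
      simp only [ev, divP, Pi.add_apply, map_add, Finset.sum_add_distrib] at h1 h2 ⊢
      rw [h1, h2, add_zero]
  smul_mem' := by
    rintro c q ⟨⟨p, hp, h⟩, hd⟩
    refine ⟨⟨c • p, Submodule.smul_mem _ c hp, fun x i => ?_⟩, fun f hf x hx => ?_⟩
    · have h1 := h x i
      simp only [ev, Pi.smul_apply, smul_eval] at h1 ⊢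
      rw [h1]; ring
    · have h1 := hd f hf x hx
      simp only [ev, divP, Pi.smul_apply, Derivation.map_smul, map_sum, smul_eval,
        ← Finset.mul_sum] at h1 ⊢
      rw [h1, mul_zero]

/-! ### Degrees of freedom

A family of moments `(g, q)_s`, `q ∈ P_m(s)`, is prescribed by a linear functional on `P_m(s)`. -/

/-- Prescribed values of `v`, `∇v`, `∇²v` and `∇²(div v)` at a vertex. -/
structure VertexData where
  val : Fin 3 → ℝ
  grad : Matrix (Fin 3) (Fin 3) ℝ
  hess : Fin 3 → Matrix (Fin 3) (Fin 3) ℝ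
  hess_symm : ∀ i, (hess i).IsSymm
  hessDiv : Matrix (Fin 3) (Fin 3) ℝ
  hessDiv_symm : hessDiv.IsSymm

/-- Prescribed moments on an edge. -/
structure EdgeData (k : ℕ) (e : Finset E3) where
  val : Module.Dual ℝ (Fin 3 → PolyOn ((k : ℤ) - 4) e)
  div : Module.Dual ℝ (PolyOn ((k : ℤ) - 5) e)
  np_np : Module.Dual ℝ (PolyOn ((k : ℤ) - 3) e)
  np_nm : Module.Dual ℝ (PolyOn ((k : ℤ) - 3) e)
  t_np : Module.Dual ℝ (PolyOn ((k : ℤ) - 3) e)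
  t_nm : Module.Dual ℝ (PolyOn ((k : ℤ) - 3) e)
  nm_np : Module.Dual ℝ (PolyOn ((k : ℤ) - 3) e)
  div_np : Module.Dual ℝ (PolyOn ((k : ℤ) - 4) e)
  div_nm : Module.Dual ℝ (PolyOn ((k : ℤ) - 4) e)

/-- Prescribed moments on a face. -/
structure FaceData (k : ℕ) (f : Finset E3) where
  val : Module.Dual ℝ (Fin 3 → PolyOn ((k : ℤ) - 4) f)
  div : Module.Dual ℝ (PolyOn ((k : ℤ) - 5) f)

/-- The degrees of freedom of `v` at the vertex `a` are those prescribed by `D`. -/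
structure HasVertexDofs (a : E3) (v : VecPoly) (D : VertexData) : Prop where
  val : ∀ i, ev a (v i) = D.val i
  grad : ∀ i j, ev a (pderiv j (v i)) = D.grad i j
  hess : ∀ i j l, ev a (pderiv j (pderiv l (v i))) = D.hess i j l
  hessDiv : ∀ j l, ev a (pderiv j (pderiv l (divP v))) = D.hessDiv j l

/-- `(g, q)_s = ℓ(q)` for all `q ∈ P_m(s; ℝ)`, where `s` is a simplex of dimension `d` and the
integral is taken with respect to `d`-dimensional Euclidean measure (length or area). -/
def HasMoments (d : ℕ) (m : ℤ) (s : Finset E3) (g : Poly) (ℓ : Module.Dual ℝ (PolyOn m s)) : Prop :=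
  ∀ q : polyLE m, ∫ x in hull s, ev x g * ev x q ∂(μHE[d] : Measure E3) = ℓ (onto m s q)

/-- `(v, q)_s = ℓ(q)` for all `q ∈ P_m(s; ℝ³)`. -/
def HasVecMoments (d : ℕ) (m : ℤ) (s : Finset E3) (v : VecPoly)
    (ℓ : Module.Dual ℝ (Fin 3 → PolyOn m s)) : Prop :=
  ∀ q : Fin 3 → polyLE m,
    ∫ x in hull s, ∑ i, ev x (v i) * ev x (q i) ∂(μHE[d] : Measure E3) = ℓ fun i => onto m s (q i)

/-- The degrees of freedom of `v` on the edge `e` are those prescribed by `D`. -/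
structure HasEdgeDofs (k : ℕ) (e : Finset E3) (F : EdgeFrame) (v : VecPoly) (D : EdgeData k e) :
    Prop where
  val : HasVecMoments 1 ((k : ℤ) - 4) e v D.val
  div : HasMoments 1 ((k : ℤ) - 5) e (divP v) D.div
  np_np : HasMoments 1 ((k : ℤ) - 3) e (dirDeriv F.np (dotP v F.np)) D.np_np
  np_nm : HasMoments 1 ((k : ℤ) - 3) e (dirDeriv F.nm (dotP v F.np)) D.np_nm
  t_np : HasMoments 1 ((k : ℤ) - 3) e (dirDeriv F.np (dotP v F.t)) D.t_np
  t_nm : HasMoments 1 ((k : ℤ) - 3) e (dirDeriv F.nm (dotP v F.t)) D.t_nm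
  nm_np : HasMoments 1 ((k : ℤ) - 3) e (dirDeriv F.np (dotP v F.nm)) D.nm_np
  div_np : HasMoments 1 ((k : ℤ) - 4) e (dirDeriv F.np (divP v)) D.div_np
  div_nm : HasMoments 1 ((k : ℤ) - 4) e (dirDeriv F.nm (divP v)) D.div_nm

/-- The degrees of freedom of `v` on the face `f` are those prescribed by `D`. -/
structure HasFaceDofs (k : ℕ) (f : Finset E3) (v : VecPoly) (D : FaceData k f) : Prop where
  val : HasVecMoments 2 ((k : ℤ) - 4) f v D.val
  div : HasMoments 2 ((k : ℤ) - 5) f (divP v) D.div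

/-- Prescribed values for all degrees of freedom on a tetrahedron. -/
structure DofData (k : ℕ) {K : Finset E3} (hK : IsTetrahedron K) where
  vertex : K → VertexData
  edge : ∀ e : K.powersetCard 2, EdgeData k e
  face : ∀ f : K.powersetCard 3, FaceData k f
  interior : Module.Dual ℝ (divBubble k hK)

/-- All degrees of freedom of `v` on the tetrahedron `K` are those prescribed by `D`. -/
structure HasDofs (k : ℕ) {K : Finset E3} (hK : IsTetrahedron K) (frame : Finset E3 → EdgeFrame)
    (v : VecPoly) (D : DofData k hK) : Prop where
  vertex : ∀ a : K, HasVertexDofs a v (D.vertex a)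
  edge : ∀ e : K.powersetCard 2, HasEdgeDofs k e (frame e) v (D.edge e)
  face : ∀ f : K.powersetCard 3, HasFaceDofs k f v (D.face f)
  interior : ∀ q : divBubble k hK,
    ∫ x in hull K, ∑ i, ev x (v i) * ev x (q.1 i) = D.interior q

/-! ### Sobolev spaces -/

/-- `g` is the weak partial derivative `∂_j u` on `Ω`. -/
def HasWeakPartial (Ω : Set E3) (j : Fin 3) (u g : E3 → ℝ) : Prop :=
  ∀ φ : E3 → ℝ, ContDiff ℝ ∞ φ → HasCompactSupport φ → tsupport φ ⊆ Ω →
    ∫ x in Ω, u x * fderiv ℝ φ x (EuclideanSpace.single j 1) = -∫ x in Ω, g x * φ x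

/-- `u ∈ H¹(Ω; ℝ)`. -/
def MemH1 (Ω : Set E3) (u : E3 → ℝ) : Prop :=
  MemLp u 2 (volume.restrict Ω) ∧
    ∀ j, ∃ g : E3 → ℝ, MemLp g 2 (volume.restrict Ω) ∧ HasWeakPartial Ω j u g

/-- `v ∈ H¹(div, Ω; ℝ³)`: the field `v` has a square-integrable weak gradient `G`, so that
`v ∈ H¹(Ω; ℝ³)`, and its divergence `tr G` belongs to `H¹(Ω; ℝ)`. -/
def MemH1Div (Ω : Set E3) (v : E3 → E3) : Prop :=
  (∀ i, MemLp (fun x => v x i) 2 (volume.restrict Ω)) ∧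
    ∃ G : Fin 3 → Fin 3 → E3 → ℝ,
      (∀ i j, MemLp (G i j) 2 (volume.restrict Ω) ∧
        HasWeakPartial Ω j (fun x => v x i) (G i j)) ∧
      MemH1 Ω fun x => ∑ i, G i i x

/-! ### Tetrahedral grids and the global finite element space -/

/-- `T` is a (conforming) tetrahedral grid of the domain `Ω`: a finite simplicial complex in which
every simplex belongs to a tetrahedron, and which fills the closure of `Ω`. -/
structure IsTetGrid (T : Geometry.SimplicialComplex ℝ E3) (Ω : Set E3) : Prop where
  finite : T.faces.Finite
  pure : ∀ s ∈ T.faces, ∃ K ∈ T.faces, s ⊆ K ∧ K.card = 4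
  space_eq : T.space = closure Ω

/-- The tetrahedra of a grid. -/
def cells (T : Geometry.SimplicialComplex ℝ E3) : Set (Finset E3) := {K ∈ T.faces | K.card = 4}

/-- `p` assigns a polynomial of degree at most `k + 2` to each tetrahedron so that the degrees of
freedom at vertices, on edges and on faces are single-valued: tetrahedra that share a vertex, an
edge or a face have the same degrees of freedom there. -/
structure IsSingleValued (k : ℕ) (T : Geometry.SimplicialComplex ℝ E3)
    (frame : Finset E3 → EdgeFrame) (p : Finset E3 → VecPoly) : Prop where
  degree : ∀ K ∈ cells T, p K ∈ vecPolyLE ((k : ℤ) + 2)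
  vertex : ∀ a : E3, ∃ D : VertexData, ∀ K ∈ cells T, a ∈ K → HasVertexDofs a (p K) D
  edge : ∀ e : Finset E3, e.card = 2 → ∃ D : EdgeData k e,
    ∀ K ∈ cells T, e ⊆ K → HasEdgeDofs k e (frame e) (p K) D
  face : ∀ f : Finset E3, f.card = 3 → ∃ D : FaceData k f,
    ∀ K ∈ cells T, f ⊆ K → HasFaceDofs k f (p K) D

/-- The global finite element space: fields that on each tetrahedron coincide (almost everywhere)
with a polynomial of degree at most `k + 2`, with single-valued degrees of freedom. -/
def globalSpace (k : ℕ) (T : Geometry.SimplicialComplex ℝ E3) (frame : Finset E3 → EdgeFrame) :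
    Set (E3 → E3) :=
  {v | ∃ p : Finset E3 → VecPoly, IsSingleValued k T frame p ∧
    ∀ K ∈ cells T, ∀ᵐ x ∂volume.restrict (hull K), ∀ i, v x i = ev x (p K i)}

end TetElement

end

/-!
# Unisolvence and conformity of an `H¹(div)` tetrahedral element

*Uniqueness.* Let all degrees of freedom of `v` vanish. For a simplex `s`, the tool is the affine
retraction of `ℝ³` onto the affine span of `s` given by barycentric coordinates `μ_a`, together with
the pullback of polynomials along it (`Bary.pull`). Affine functions are prime polynomials that
divide exactly the polynomials vanishing on their planes, so vanishing of order `n` on the facets of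
`s` makes `∏ μ_a ^ n` divide the pullback (`Bary.pow_dvd_pull`, `Bary.prod_pow_dvd`). The quotient
has low enough degree to serve as a test function, and the moments force it to be zero
(`vanishes_of_zeroMoments`). Applied to an edge, this gives `v = 0`, `div v = 0`, `∇(div v) = 0` and
all but one entry of `∇v` in an adapted frame; the remaining entry is supplied by the trace `div v`
(`flat_edge`). Applied to a face, it gives `v = 0` and `div v = 0` (`vanishes_on_face`). Hence `v` is
a divergence bubble, orthogonal to itself (`eq_zero_of_zeroDofs`).

*Existence.* The degrees of freedom form a linear map into a space of dimension at most
`dim P_{k+2}(K; ℝ³)` (`finrank_dofSpace_le`), and an injective such map is surjective. In this count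
only upper bounds for the dimensions of the test spaces are needed. For a bubble `λ₁λ₂λ₃λ₄ p`, the
divergence vanishes on the faces only if `∇λ_a · p = λ_a h_a` with `h_a ∈ P_{k-3}`; the `h_a` satisfy
`∑ λ_a h_a = 0` and determine `p = ∑ λ_a h_a a`. As `(h_a) ↦ ∑ λ_a h_a` is onto `P_{k-2}`, this bounds
the dimension of the bubble space (`divBubble_le_range`, `finrank_divBubble_add_le`).

*Conformity.* Two tetrahedra of the grid meet in a common vertex, edge or face, and the argument for
uniqueness on this simplex only uses the degrees of freedom there (`ev_eq_of_isSingleValued`). For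
the weak derivatives, let `u` be a piecewise polynomial that is continuous across the tetrahedra and
`φ` a test function. Then `φ u` is a continuous selection of finitely many Lipschitz functions, hence
Lipschitz (`lipschitzWith_of_selection`), and the integral of its derivative is zero, which is the
formula of integration by parts (`hasWeakPartial_piecewise`). No boundary integrals occur.
-/

noncomputable section

namespace TetElement

/-! ### Polynomials of bounded degree -/

/-- Polynomials in `d` variables of total degree at most `m`, zero for `m < 0`; for `d = 3` this is
`polyLE m` by definition. -/
def degLE (d : ℕ) (m : ℤ) : Submodule ℝ (MvPolynomial (Fin d) ℝ) :=
  MvPolynomial.restrictSupport ℝ {s : Fin d →₀ ℕ | (s.degree : ℤ) ≤ m}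

theorem mem_degLE {d : ℕ} {m : ℤ} {p : MvPolynomial (Fin d) ℝ} :
    p ∈ degLE d m ↔ ∀ s ∈ p.support, (s.degree : ℤ) ≤ m := by
  rw [degLE, mem_restrictSupport_iff]
  exact Iff.rfl

theorem degLE_mono {d : ℕ} {m n : ℤ} (h : m ≤ n) : degLE d m ≤ degLE d n := fun _ hp =>
  mem_degLE.2 fun s hs => (mem_degLE.1 hp s hs).trans h

theorem totalDegree_le_iff_degree {d n : ℕ} {p : MvPolynomial (Fin d) ℝ} :
    p.totalDegree ≤ n ↔ ∀ s ∈ p.support, s.degree ≤ n := by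
  rw [MvPolynomial.totalDegree, Finset.sup_le_iff]
  rfl

theorem mem_degLE_iff_totalDegree {d : ℕ} {m : ℤ} {p : MvPolynomial (Fin d) ℝ} (hp : p ≠ 0) :
    p ∈ degLE d m ↔ (p.totalDegree : ℤ) ≤ m := by
  rw [mem_degLE]
  constructor
  · intro h
    obtain ⟨s, hs⟩ := support_nonempty.2 hp
    have hm : 0 ≤ m := le_trans (by positivity) (h s hs)
    lift m to ℕ using hm
    exact_mod_cast totalDegree_le_iff_degree.2 fun s hs => by exact_mod_cast h s hs
  · intro h s hs
    have := totalDegree_le_iff_degree.1 le_rfl s hs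
    omega

theorem mul_mem_degLE {d : ℕ} {m n : ℤ} {p q : MvPolynomial (Fin d) ℝ} (hp : p ∈ degLE d m)
    (hq : q ∈ degLE d n) : p * q ∈ degLE d (m + n) := by
  by_cases hp0 : p = 0
  · simp [hp0]
  by_cases hq0 : q = 0
  · simp [hq0]
  rw [mem_degLE_iff_totalDegree (mul_ne_zero hp0 hq0), totalDegree_mul_of_isDomain hp0 hq0]
  rw [mem_degLE_iff_totalDegree hp0] at hp
  rw [mem_degLE_iff_totalDegree hq0] at hq
  push_cast
  omega

theorem mem_degLE_of_mul {d : ℕ} {m : ℤ} {p q : MvPolynomial (Fin d) ℝ} (hp : p ≠ 0)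
    (h : p * q ∈ degLE d m) : q ∈ degLE d (m - p.totalDegree) := by
  by_cases hq : q = 0
  · simp [hq]
  rw [mem_degLE_iff_totalDegree (mul_ne_zero hp hq), totalDegree_mul_of_isDomain hp hq] at h
  rw [mem_degLE_iff_totalDegree hq]
  push_cast at h
  omega

theorem C_mem_degLE {d : ℕ} {m : ℤ} (hm : 0 ≤ m) (c : ℝ) : C c ∈ degLE d m := by
  by_cases hc : (C c : MvPolynomial (Fin d) ℝ) = 0
  · simp [hc]
  · simpa [mem_degLE_iff_totalDegree hc] using hm

theorem X_mem_degLE {d : ℕ} (i : Fin d) : X i ∈ degLE d 1 := by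
  simp [mem_degLE_iff_totalDegree (X_ne_zero (R := ℝ) i)]

/-- Substituting polynomials of degree at most one does not raise the degree. -/
theorem aeval_mem_degLE {d e : ℕ} {m : ℤ} {f : Fin d → MvPolynomial (Fin e) ℝ}
    (hf : ∀ i, f i ∈ degLE e 1) {g : MvPolynomial (Fin d) ℝ} (hg : g ∈ degLE d m) :
    aeval f g ∈ degLE e m := by
  have hf' : ∀ i, (f i).totalDegree ≤ 1 := fun i => by
    by_cases h : f i = 0
    · simp [h]
    · exact_mod_cast (mem_degLE_iff_totalDegree h).1 (hf i)
  rw [g.as_sum, map_sum]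
  refine Submodule.sum_mem _ fun s hs => ?_
  rw [aeval_monomial]
  refine degLE_mono (mem_degLE.1 hg s hs) ?_
  by_cases h : (algebraMap ℝ (MvPolynomial (Fin e) ℝ)) (coeff s g) *
      s.prod (fun i k => f i ^ k) = 0
  · rw [h]; exact Submodule.zero_mem _
  rw [mem_degLE_iff_totalDegree h]
  norm_cast
  refine (totalDegree_mul _ _).trans ?_
  rw [algebraMap_eq, totalDegree_C, zero_add, Finsupp.prod]
  refine (totalDegree_finsetProd _ _).trans ?_
  rw [Finsupp.degree_apply]
  refine Finset.sum_le_sum fun i _ => (totalDegree_pow _ _).trans ?_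
  exact (Nat.mul_le_mul_left _ (hf' i)).trans (by simp)

theorem pderiv_mem_degLE {d : ℕ} {m : ℤ} (i : Fin d) {g : MvPolynomial (Fin d) ℝ}
    (hg : g ∈ degLE d m) : pderiv i g ∈ degLE d (m - 1) := by
  rw [g.as_sum, map_sum]
  refine Submodule.sum_mem _ fun s hs => ?_
  rw [pderiv_monomial]
  have hs := mem_degLE.1 hg s hs
  by_cases h : s i = 0
  · simp [h]
  refine (monomial_mem_restrictSupport ℝ).2 (Or.inl ?_)
  have h1 : Finsupp.single i 1 ≤ s := by
    rw [Finsupp.single_le_iff]; omega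
  have h2 : (s - Finsupp.single i 1).degree + 1 = s.degree := by
    conv_rhs => rw [← tsub_add_cancel_of_le h1]
    simp
  change ((s - Finsupp.single i 1).degree : ℤ) ≤ m - 1
  omega

instance finite_degLE (d : ℕ) (m : ℤ) : Module.Finite ℝ (degLE d m) := by
  have : (degLE d m) ≤ restrictTotalDegree (Fin d) ℝ m.toNat := fun p hp => by
    rw [mem_restrictTotalDegree]
    by_cases h : p = 0
    · simp [h]
    · have := (mem_degLE_iff_totalDegree h).1 hp
      omega
  exact Module.Finite.of_injective (Submodule.inclusion this) (Submodule.inclusion_injective this)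

/-! ### Affine functions as polynomials -/

theorem ev_ext {p q : Poly} (h : ∀ x, ev x p = ev x q) : p = q :=
  MvPolynomial.funext fun x => h (WithLp.toLp 2 x)

/-- An affine function on `ℝ³` as a polynomial. -/
def affPoly (f : E3 →ᵃ[ℝ] ℝ) : Poly :=
  C (f 0) + ∑ i, C (f.linear (EuclideanSpace.single i 1)) * X i

theorem sum_smul_single (x : E3) : ∑ i, x i • EuclideanSpace.single i (1 : ℝ) = x := by
  ext j
  simp [Finset.sum_apply, Pi.single_apply]

theorem affineMap_eq_linear_add (f : E3 →ᵃ[ℝ] ℝ) (x : E3) : f x = f.linear x + f 0 :=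
  congrFun f.decomp x

theorem ev_affPoly (f : E3 →ᵃ[ℝ] ℝ) (x : E3) : ev x (affPoly f) = f x := by
  rw [affineMap_eq_linear_add f x]
  conv_rhs => rw [← sum_smul_single x]
  simp [affPoly, ev, add_comm, mul_comm]

theorem pderiv_affPoly (f : E3 →ᵃ[ℝ] ℝ) (j : Fin 3) :
    pderiv j (affPoly f) = C (f.linear (EuclideanSpace.single j 1)) := by
  simp [affPoly, pderiv_X, Pi.single_apply]

theorem affPoly_mem_polyLE (f : E3 →ᵃ[ℝ] ℝ) : affPoly f ∈ degLE 3 1 :=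
  Submodule.add_mem _ (C_mem_degLE zero_le_one _) <| Submodule.sum_mem _ fun i _ => by
    simpa using mul_mem_degLE (C_mem_degLE le_rfl _) (X_mem_degLE i)

theorem exists_linear_single_ne_zero {f : E3 →ᵃ[ℝ] ℝ} (hf : f.linear ≠ 0) :
    ∃ j : Fin 3, f.linear (EuclideanSpace.single j 1) ≠ 0 := by
  by_contra! h
  refine hf (LinearMap.ext fun x => ?_)
  rw [← sum_smul_single x]
  simp [h]

theorem affPoly_ne_zero {f : E3 →ᵃ[ℝ] ℝ} (hf : f.linear ≠ 0) : affPoly f ≠ 0 := by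
  obtain ⟨j, hj⟩ := exists_linear_single_ne_zero hf
  intro h
  have := pderiv_affPoly f j
  rw [h, map_zero, eq_comm, map_eq_zero] at this
  exact hj this

theorem totalDegree_affPoly {f : E3 →ᵃ[ℝ] ℝ} (hf : f.linear ≠ 0) :
    (affPoly f).totalDegree = 1 := by
  refine le_antisymm ?_ (Nat.one_le_iff_ne_zero.2 fun h => ?_)
  · exact_mod_cast (mem_degLE_iff_totalDegree (affPoly_ne_zero hf)).1 (affPoly_mem_polyLE f)
  · obtain ⟨j, hj⟩ := exists_linear_single_ne_zero hf
    have := pderiv_affPoly f j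
    rw [totalDegree_eq_zero_iff_eq_C.1 h, pderiv_C, eq_comm, map_eq_zero] at this
    exact hj this

theorem eval_aeval {d e : ℕ} (r : Fin d → MvPolynomial (Fin e) ℝ) (y : Fin e → ℝ)
    (p : MvPolynomial (Fin d) ℝ) : eval y (aeval r p) = eval (fun i => eval y (r i)) p := by
  induction p using MvPolynomial.induction_on with
  | C a => simp
  | add p q hp hq => simp only [map_add, hp, hq]
  | mul_X p i hp => simp only [map_mul, hp, aeval_X, eval_X]

/-- There is an algebra endomorphism that pulls polynomials back along the projection onto the
plane `f = 0` in the direction of a coordinate axis; its kernel consists of the multiples of `f`. -/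
theorem exists_projection {f : E3 →ᵃ[ℝ] ℝ} (hf : f.linear ≠ 0) :
    ∃ σ : Poly →ₐ[ℝ] Poly, (∀ p, affPoly f ∣ p ↔ σ p = 0) ∧
      ∀ x, ∃ y, f y = 0 ∧ ∀ p, ev x (σ p) = ev y p := by
  obtain ⟨j, hj⟩ := exists_linear_single_ne_zero hf
  set c := f.linear (EuclideanSpace.single j 1) with hc
  set r : Fin 3 → Poly := fun i => X i - if i = j then C c⁻¹ * affPoly f else 0 with hr
  have key : ∀ p : Poly, affPoly f ∣ p - aeval r p := by
    intro p
    induction p using MvPolynomial.induction_on with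
    | C a => simp [← algebraMap_eq]
    | add p q hp hq =>
      rw [map_add, add_sub_add_comm]
      exact dvd_add hp hq
    | mul_X p i hp =>
      have h1 : affPoly f ∣ X i - r i := by
        simp only [hr, sub_sub_cancel]
        split_ifs
        · exact dvd_mul_left _ _
        · exact dvd_zero _
      have h2 : p * X i - aeval r (p * X i) = (p - aeval r p) * X i + aeval r p * (X i - r i) := by
        rw [map_mul, aeval_X]; ring
      rw [h2]
      exact dvd_add (hp.mul_right _) (h1.mul_left _)
  have hpt : ∀ x, ∃ y, f y = 0 ∧ ∀ p, ev x (aeval r p) = ev y p := by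
    intro x
    refine ⟨x - (c⁻¹ * f x) • EuclideanSpace.single j 1, ?_, fun p => ?_⟩
    · rw [affineMap_eq_linear_add, map_sub, map_smul, ← hc, affineMap_eq_linear_add f x, smul_eq_mul]
      field_simp
      ring
    · have hrx : ∀ i, eval x.ofLp (r i) =
          (x - (c⁻¹ * f x) • EuclideanSpace.single j (1 : ℝ) : E3).ofLp i := fun i => by
        have h := ev_affPoly f x
        rw [ev] at h
        by_cases hij : i = j
        · subst hij
          simp [hr, h]
        · simp [hr, hij]
      unfold ev
      rw [eval_aeval, funext hrx]
  refine ⟨aeval r, fun p => ⟨?_, fun h => by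
    have := key p
    rwa [h, sub_zero] at this⟩, hpt⟩
  rintro ⟨q, rfl⟩
  refine ev_ext fun x => ?_
  obtain ⟨y, hy, hp⟩ := hpt x
  rw [hp]
  simp only [ev, map_mul, map_zero]
  have := ev_affPoly f y
  rw [ev] at this
  rw [this, hy, zero_mul]


theorem affPoly_dvd_iff {f : E3 →ᵃ[ℝ] ℝ} (hf : f.linear ≠ 0) {p : Poly} :
    affPoly f ∣ p ↔ ∀ x, f x = 0 → ev x p = 0 := by
  refine ⟨?_, fun h => ?_⟩
  · rintro ⟨q, rfl⟩ x hx
    have := ev_affPoly f x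
    rw [ev] at this ⊢
    rw [map_mul, this, hx, zero_mul]
  · obtain ⟨σ, hσ, hpt⟩ := exists_projection hf
    refine (hσ p).2 (ev_ext fun x => ?_)
    obtain ⟨y, hy, hp⟩ := hpt x
    rw [hp, h y hy]
    simp [ev]

/-- Divisibility by `f` is the vanishing of an endomorphism of a domain. -/
theorem prime_affPoly {f : E3 →ᵃ[ℝ] ℝ} (hf : f.linear ≠ 0) : Prime (affPoly f) := by
  obtain ⟨σ, hσ, -⟩ := exists_projection hf
  refine ⟨affPoly_ne_zero hf, fun h => ?_, fun a b h => ?_⟩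
  · simpa using (hσ 1).1 h.dvd
  · rwa [hσ, map_mul, mul_eq_zero, ← hσ, ← hσ] at h

/-! ### Directional derivatives and orders of vanishing -/

theorem dirDeriv_add (n : E3) (p q : Poly) :
    dirDeriv n (p + q) = dirDeriv n p + dirDeriv n q := by
  simp [dirDeriv, mul_add, Finset.sum_add_distrib]

theorem dirDeriv_smul (n : E3) (c : ℝ) (p : Poly) : dirDeriv n (c • p) = c • dirDeriv n p := by
  simp [dirDeriv, Finset.smul_sum]

theorem dirDeriv_C (n : E3) (c : ℝ) : dirDeriv n (C c) = 0 := by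
  simp [dirDeriv]

theorem dirDeriv_mul (n : E3) (p q : Poly) :
    dirDeriv n (p * q) = dirDeriv n p * q + p * dirDeriv n q := by
  simp only [dirDeriv, Derivation.leibniz, smul_eq_mul, Finset.sum_mul, Finset.mul_sum,
    ← Finset.sum_add_distrib]
  exact Finset.sum_congr rfl fun i _ => by ring

theorem dirDeriv_X (n : E3) (i : Fin 3) : dirDeriv n (X i) = C (n i) := by
  simp [dirDeriv, pderiv_X, Pi.single_apply]

theorem dirDeriv_affPoly (n : E3) (f : E3 →ᵃ[ℝ] ℝ) :
    dirDeriv n (affPoly f) = C (f.linear n) := by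
  conv_rhs => rw [← sum_smul_single n]
  simp [dirDeriv, pderiv_affPoly]

theorem dirDeriv_pow_succ (n : E3) (p : Poly) (k : ℕ) :
    dirDeriv n (p ^ (k + 1)) = C ((k : ℝ) + 1) * p ^ k * dirDeriv n p := by
  induction k with
  | zero => simp
  | succ k ih =>
    rw [pow_succ, dirDeriv_mul, ih]
    push_cast
    simp only [map_add, map_one]
    ring

/-- If the derivatives of order less than `k` in a transversal direction vanish on a plane, then
`p` is divisible by the `k`-th power of the equation of the plane. -/
theorem pow_dvd_of_dirDeriv {f : E3 →ᵃ[ℝ] ℝ} {n : E3} (hn : f.linear n ≠ 0) {k : ℕ} {p : Poly}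
    (h : ∀ j < k, affPoly f ∣ (dirDeriv n)^[j] p) : affPoly f ^ k ∣ p := by
  have hf : f.linear ≠ 0 := fun h => hn (by simp [h])
  induction k generalizing p with
  | zero => simp
  | succ k ih =>
    obtain ⟨q, hq⟩ := ih fun j hj => h j (hj.trans k.lt_succ_self)
    have hD : affPoly f ^ k ∣ dirDeriv n p := ih fun j hj => by
      simpa using h (j + 1) (Nat.succ_lt_succ hj)
    cases k with
    | zero => simpa using h 0 zero_lt_one
    | succ k =>
      have h1 : dirDeriv n p = affPoly f ^ k * (C (((k : ℝ) + 1) * f.linear n) * q) +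
          affPoly f ^ (k + 1) * dirDeriv n q := by
        rw [hq, dirDeriv_mul, dirDeriv_pow_succ, dirDeriv_affPoly, C_mul]
        ring
      rw [h1, dvd_add_left (dvd_mul_right _ _), pow_succ,
        mul_dvd_mul_iff_left (pow_ne_zero _ (affPoly_ne_zero hf))] at hD
      have hu : IsUnit (C (((k : ℝ) + 1) * f.linear n) : Poly) :=
        (IsUnit.mk0 _ (mul_ne_zero (by positivity) hn)).map C
      rw [hu.dvd_mul_left] at hD
      rw [hq, pow_succ _ (k + 1)]
      exact mul_dvd_mul_left _ hD

/-! ### Barycentric coordinates of a simplex and the retraction onto its affine span -/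

/-- Barycentric coordinates of the simplex with vertex set `s`, extended to affine functions on
`ℝ³`. Only the values of `coord` at the points of `s` matter. -/
structure Bary (s : Finset E3) where
  coord : E3 → E3 →ᵃ[ℝ] ℝ
  sum_coord : ∀ x, ∑ a ∈ s, coord a x = 1
  coord_self : ∀ a ∈ s, coord a a = 1
  coord_ne : ∀ a ∈ s, ∀ b ∈ s, a ≠ b → coord a b = 0

/-- `p` vanishes on the affine span of `s`, whose points are written as affine combinations of the
points of `s`. -/
def Vanishes (s : Finset E3) (p : Poly) : Prop :=
  ∀ w : E3 → ℝ, ∑ a ∈ s, w a = 1 → ev (∑ a ∈ s, w a • a) p = 0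

theorem affineMap_sum_smul (f : E3 →ᵃ[ℝ] ℝ) {s : Finset E3} {w : E3 → ℝ}
    (hw : ∑ a ∈ s, w a = 1) : f (∑ a ∈ s, w a • a) = ∑ a ∈ s, w a * f a := by
  rw [affineMap_eq_linear_add, map_sum]
  conv_lhs => rw [← one_mul (f 0), ← hw, Finset.sum_mul, ← Finset.sum_add_distrib]
  refine Finset.sum_congr rfl fun a _ => ?_
  rw [affineMap_eq_linear_add f a, map_smul, smul_eq_mul, mul_add]

namespace Bary

variable {s : Finset E3} (B : Bary s)

theorem coord_sum_smul {w : E3 → ℝ} (hw : ∑ a ∈ s, w a = 1) {a : E3} (ha : a ∈ s) :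
    B.coord a (∑ b ∈ s, w b • b) = w a := by
  rw [affineMap_sum_smul _ hw, Finset.sum_eq_single_of_mem a ha, B.coord_self a ha, mul_one]
  intro b hb hba
  rw [B.coord_ne a ha b hb hba.symm, mul_zero]

/-- The affine retraction of `ℝ³` onto the affine span of `s`. -/
def proj (x : E3) : E3 := ∑ a ∈ s, B.coord a x • a

/-- Pullback of polynomials along the retraction `proj`. -/
def pull : Poly →ₐ[ℝ] Poly := aeval fun i => ∑ a ∈ s, C (a i) * affPoly (B.coord a)

theorem ev_pull (x : E3) (p : Poly) : ev x (B.pull p) = ev (B.proj x) p := by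
  rw [ev, pull, eval_aeval, ev]
  congr 2
  ext i
  rw [map_sum, proj]
  simp only [WithLp.ofLp_sum, Finset.sum_apply]
  refine Finset.sum_congr rfl fun a _ => ?_
  have := ev_affPoly (B.coord a) x
  rw [ev] at this
  rw [map_mul, this, eval_C, mul_comm]
  rfl

theorem proj_sum_smul {w : E3 → ℝ} (hw : ∑ a ∈ s, w a = 1) :
    B.proj (∑ a ∈ s, w a • a) = ∑ a ∈ s, w a • a :=
  Finset.sum_congr rfl fun _ ha => by rw [B.coord_sum_smul hw ha]

theorem vanishes_iff_pull_eq_zero {p : Poly} : Vanishes s p ↔ B.pull p = 0 := by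
  refine ⟨fun h => ev_ext fun x => ?_, fun h w hw => ?_⟩
  · rw [ev_pull]
    exact (h _ (B.sum_coord x)).trans (by simp [ev])
  · rw [← B.proj_sum_smul hw, ← ev_pull, h]
    simp [ev]

theorem pull_mem_polyLE {m : ℤ} {p : Poly} (hp : p ∈ polyLE m) : B.pull p ∈ polyLE m :=
  aeval_mem_degLE (fun i => Submodule.sum_mem _ fun a _ => by
    simpa using mul_mem_degLE (C_mem_degLE le_rfl _) (affPoly_mem_polyLE _)) hp

theorem linear_sub (f : E3 →ᵃ[ℝ] ℝ) (a b : E3) : f.linear (a - b) = f a - f b := by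
  rw [← vsub_eq_sub, f.linearMap_vsub, vsub_eq_sub]

/-- The retraction commutes with derivatives in the directions of the simplex. -/
theorem pull_dirDeriv {a b : E3} (ha : a ∈ s) (hb : b ∈ s) (p : Poly) :
    B.pull (dirDeriv (a - b) p) = dirDeriv (a - b) (B.pull p) := by
  induction p using MvPolynomial.induction_on with
  | C c => rw [dirDeriv_C, map_zero, ← algebraMap_eq, AlgHom.commutes, algebraMap_eq, dirDeriv_C]
  | add p q hp hq => simp only [map_add, dirDeriv_add, hp, hq]
  | mul_X p i hp =>
    have h1 : B.pull (X i) = ∑ c ∈ s, C (c i) * affPoly (B.coord c) := by simp [pull]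
    have h2 : dirDeriv (a - b) (B.pull (X i)) = C ((a - b) i) := by
      have : ∀ c ∈ s, ∀ y ∈ s, B.coord c y = if c = y then 1 else 0 := fun c hc y hy => by
        split_ifs with h
        · rw [← h, B.coord_self c hc]
        · exact B.coord_ne c hc y hy h
      have hD : ∀ t : Finset E3, ∀ g : E3 → Poly,
          dirDeriv (a - b) (∑ c ∈ t, g c) = ∑ c ∈ t, dirDeriv (a - b) (g c) := fun t g => by
        simp only [dirDeriv, map_sum, Finset.mul_sum]
        exact Finset.sum_comm
      rw [h1, hD]
      have : ∀ c ∈ s, dirDeriv (a - b) (C (c i) * affPoly (B.coord c)) =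
          (if c = a then C (c i) else 0) - if c = b then C (c i) else 0 := fun c hc => by
        rw [dirDeriv_mul, dirDeriv_C, dirDeriv_affPoly, linear_sub, this c hc a ha, this c hc b hb]
        split_ifs <;> simp
      rw [Finset.sum_congr rfl this, Finset.sum_sub_distrib, Finset.sum_ite_eq' _ a,
        Finset.sum_ite_eq' _ b, if_pos ha, if_pos hb, ← C_sub]
      rfl
    have h3 : B.pull (C ((a - b) i)) = C ((a - b) i) := by
      rw [← algebraMap_eq, AlgHom.commutes]
    simp only [map_mul, dirDeriv_mul, map_add, hp, h2, dirDeriv_X, h3]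

theorem pull_iterate_dirDeriv {a b : E3} (ha : a ∈ s) (hb : b ∈ s) (p : Poly) (j : ℕ) :
    B.pull ((dirDeriv (a - b))^[j] p) = (dirDeriv (a - b))^[j] (B.pull p) := by
  induction j generalizing p with
  | zero => rfl
  | succ j ih => rw [Function.iterate_succ_apply, Function.iterate_succ_apply, ih,
      B.pull_dirDeriv ha hb]

theorem linear_coord_sub {a b : E3} (ha : a ∈ s) (hb : b ∈ s) (hab : a ≠ b) :
    (B.coord a).linear (a - b) = 1 := by
  rw [linear_sub, B.coord_self a ha, B.coord_ne a ha b hb hab, sub_zero]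

theorem linear_coord_ne_zero {a b : E3} (ha : a ∈ s) (hb : b ∈ s) (hab : a ≠ b) :
    (B.coord a).linear ≠ 0 := fun h => by
  simpa [h] using B.linear_coord_sub ha hb hab

open Classical in
/-- The retraction maps the plane `μ_a = 0` to the affine span of the facet opposite to `a`. -/
theorem dvd_pull_of_vanishes {a b : E3} (ha : a ∈ s) (hb : b ∈ s) (hab : a ≠ b) {p : Poly}
    (h : Vanishes (s.erase a) p) : affPoly (B.coord a) ∣ B.pull p := by
  rw [affPoly_dvd_iff (B.linear_coord_ne_zero ha hb hab)]
  intro x hx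
  have h1 := B.sum_coord x
  rw [← Finset.add_sum_erase _ _ ha, hx, zero_add] at h1
  rw [ev_pull, proj, ← Finset.add_sum_erase _ _ ha, hx, zero_smul, zero_add]
  exact h _ h1

open Classical in
/-- Vanishing of order `k` on the facet opposite to `a`, tested in the direction of an edge at `a`. -/
theorem pow_dvd_pull {a b : E3} (ha : a ∈ s) (hb : b ∈ s) (hab : a ≠ b) {p : Poly} {k : ℕ}
    (h : ∀ j < k, Vanishes (s.erase a) ((dirDeriv (a - b))^[j] p)) :
    affPoly (B.coord a) ^ k ∣ B.pull p := by
  refine pow_dvd_of_dirDeriv (n := a - b) ?_ fun j hj => ?_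
  · rw [B.linear_coord_sub ha hb hab]
    exact one_ne_zero
  · rw [← B.pull_iterate_dirDeriv ha hb]
    exact B.dvd_pull_of_vanishes ha hb hab (h j hj)

theorem prime_coord (hs : 1 < s.card) {a : E3} (ha : a ∈ s) : Prime (affPoly (B.coord a)) := by
  obtain ⟨b, hb, hba⟩ := Finset.exists_mem_ne hs a
  exact prime_affPoly (B.linear_coord_ne_zero ha hb hba.symm)

theorem totalDegree_coord (hs : 1 < s.card) {a : E3} (ha : a ∈ s) :
    (affPoly (B.coord a)).totalDegree = 1 := by
  obtain ⟨b, hb, hba⟩ := Finset.exists_mem_ne hs a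
  exact totalDegree_affPoly (B.linear_coord_ne_zero ha hb hba.symm)

theorem not_coord_dvd_coord {a b : E3} (ha : a ∈ s) (hb : b ∈ s) (hab : a ≠ b) :
    ¬ affPoly (B.coord a) ∣ affPoly (B.coord b) := by
  rw [affPoly_dvd_iff (B.linear_coord_ne_zero ha hb hab)]
  intro h
  have := h b (B.coord_ne a ha b hb hab)
  rw [ev_affPoly, B.coord_self b hb] at this
  exact one_ne_zero this

theorem prod_pow_dvd (hs : 1 < s.card) {k : ℕ} {p : Poly}
    (h : ∀ a ∈ s, affPoly (B.coord a) ^ k ∣ p) : ∏ a ∈ s, affPoly (B.coord a) ^ k ∣ p := by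
  refine Finset.prod_dvd_of_isRelPrime (fun a ha b hb hab => ?_) h
  refine IsRelPrime.pow ?_
  exact (B.prime_coord hs ha).irreducible.isRelPrime_iff_not_dvd.2
    (B.not_coord_dvd_coord ha hb hab)

theorem prod_pow_ne_zero (hs : 1 < s.card) (k : ℕ) : ∏ a ∈ s, affPoly (B.coord a) ^ k ≠ 0 :=
  Finset.prod_ne_zero_iff.2 fun _ ha => pow_ne_zero _ (B.prime_coord hs ha).ne_zero

theorem totalDegree_prod_pow (hs : 1 < s.card) (k : ℕ) :
    (∏ a ∈ s, affPoly (B.coord a) ^ k).totalDegree = k * s.card := by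
  have h1 : ∀ t ⊆ s, (∏ a ∈ t, affPoly (B.coord a)).totalDegree = t.card := by
    intro t
    induction t using Finset.cons_induction with
    | empty => simp
    | cons a t hat ih =>
      intro ht
      have hts : t ⊆ s := (Finset.subset_cons hat).trans ht
      rw [Finset.prod_cons, totalDegree_mul_of_isDomain (B.prime_coord hs
        (ht (Finset.mem_cons_self a t))).ne_zero
        (Finset.prod_ne_zero_iff.2 fun b hb => (B.prime_coord hs (hts hb)).ne_zero),
        ih hts, B.totalDegree_coord hs (ht (Finset.mem_cons_self a t)), Finset.card_cons, add_comm]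
  have h2 : ∀ p : Poly, p ≠ 0 → (p ^ k).totalDegree = k * p.totalDegree := fun p hp => by
    induction k with
    | zero => simp
    | succ k ih => rw [pow_succ, totalDegree_mul_of_isDomain (pow_ne_zero _ hp) hp, ih]; ring
  have h3 := B.prod_pow_ne_zero hs 1
  simp only [pow_one] at h3
  rw [Finset.prod_pow, h2 _ h3, h1 s subset_rfl]

end Bary

/-! ### Barycentric coordinates of a tetrahedron and of its faces -/

variable {K : Finset E3}

theorem affineMap_finsetSum_apply (t : Finset E3) (f : E3 → E3 →ᵃ[ℝ] ℝ) (x : E3) :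
    (∑ b ∈ t, f b) x = ∑ b ∈ t, f b x :=
  map_sum (⟨⟨fun g : E3 →ᵃ[ℝ] ℝ => g x, rfl⟩, fun _ _ => rfl⟩ : (E3 →ᵃ[ℝ] ℝ) →+ ℝ) _ _

open Classical in
/-- The barycentric coordinates of a tetrahedron. -/
def IsTetrahedron.bary (hK : IsTetrahedron K) : Bary K where
  coord a := if h : a ∈ K then hK.basis.coord ⟨a, h⟩ else 0
  sum_coord x := by
    rw [← hK.basis.sum_coord_apply_eq_one x, ← Finset.sum_coe_sort]
    simp
  coord_self a ha := by
    simp only [dif_pos ha]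
    exact hK.basis.coord_apply_eq ⟨a, ha⟩
  coord_ne a ha b hb hab := by
    simp only [dif_pos ha]
    exact hK.basis.coord_apply_ne (i := ⟨a, ha⟩) (j := ⟨b, hb⟩) (by simpa using hab)

theorem IsTetrahedron.bary_coord (hK : IsTetrahedron K) (a : K) :
    hK.bary.coord a = hK.basis.coord a := by
  simp [IsTetrahedron.bary]

theorem IsTetrahedron.proj_bary (hK : IsTetrahedron K) (x : E3) : hK.bary.proj x = x := by
  conv_rhs => rw [← hK.basis.linear_combination_coord_eq_self x]
  rw [Bary.proj, ← Finset.sum_coe_sort]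
  exact Finset.sum_congr rfl fun a _ => by rw [hK.bary_coord]; rfl

theorem IsTetrahedron.pull_bary (hK : IsTetrahedron K) (p : Poly) : hK.bary.pull p = p :=
  ev_ext fun x => by rw [Bary.ev_pull, hK.proj_bary]

open Classical in
/-- Barycentric coordinates of a subsimplex of a tetrahedron: the coordinates belonging to the
remaining vertices are distributed evenly. -/
def IsTetrahedron.subBary (hK : IsTetrahedron K) {s : Finset E3} (hs : s ⊆ K)
    (hs0 : s.Nonempty) : Bary s where
  coord a := hK.bary.coord a + (s.card : ℝ)⁻¹ • ∑ b ∈ K \ s, hK.bary.coord b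
  sum_coord x := by
    have h0 : (s.card : ℝ) ≠ 0 := by simpa using hs0.ne_empty
    simp only [AffineMap.coe_add, AffineMap.coe_smul, Pi.add_apply, Pi.smul_apply, smul_eq_mul,
      Finset.sum_add_distrib, Finset.sum_const, nsmul_eq_mul, affineMap_finsetSum_apply]
    rw [mul_inv_cancel_left₀ h0, add_comm, Finset.sum_sdiff hs, hK.bary.sum_coord]
  coord_self a ha := by
    simp only [AffineMap.coe_add, AffineMap.coe_smul, Pi.add_apply, Pi.smul_apply,
      affineMap_finsetSum_apply]
    rw [hK.bary.coord_self a (hs ha), Finset.sum_eq_zero, smul_zero, add_zero]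
    intro b hb
    rw [Finset.mem_sdiff] at hb
    exact hK.bary.coord_ne b hb.1 a (hs ha) fun h => hb.2 (h ▸ ha)
  coord_ne a ha c hc hac := by
    simp only [AffineMap.coe_add, AffineMap.coe_smul, Pi.add_apply, Pi.smul_apply,
      affineMap_finsetSum_apply]
    rw [hK.bary.coord_ne a (hs ha) c (hs hc) hac, Finset.sum_eq_zero, smul_zero, add_zero]
    intro b hb
    rw [Finset.mem_sdiff] at hb
    exact hK.bary.coord_ne b hb.1 c (hs hc) fun h => hb.2 (h ▸ hc)


/-! ### Integration over simplices -/

theorem mem_hull_iff {s : Finset E3} {x : E3} : x ∈ hull s ↔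
    ∃ w : E3 → ℝ, (∀ a ∈ s, 0 ≤ w a) ∧ ∑ a ∈ s, w a = 1 ∧ ∑ a ∈ s, w a • a = x :=
  Finset.mem_convexHull' (R := ℝ)

theorem isCompact_hull (s : Finset E3) : IsCompact (hull s) :=
  s.finite_toSet.isCompact_convexHull ℝ

theorem continuous_ev (p : Poly) : Continuous fun x => ev x p :=
  (MvPolynomial.continuous_eval p).comp (PiLp.continuous_ofLp 2 _)

theorem Vanishes.ev_eq_zero {s : Finset E3} {p : Poly} (h : Vanishes s p) {x : E3}
    (hx : x ∈ hull s) : ev x p = 0 := by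
  obtain ⟨w, -, hw, rfl⟩ := mem_hull_iff.1 hx
  exact h w hw

theorem Bary.coord_nonneg {s : Finset E3} (B : Bary s) {x : E3} (hx : x ∈ hull s) {a : E3}
    (ha : a ∈ s) : 0 ≤ B.coord a x := by
  obtain ⟨w, hw0, hw, rfl⟩ := mem_hull_iff.1 hx
  rw [B.coord_sum_smul hw ha]
  exact hw0 a ha

/-- The inclusion of the direction of the affine span of `s`, translated to pass through `a`. -/
def spanEmb (s : Finset E3) (a : E3) (w : vectorSpan ℝ (s : Set E3)) : E3 := w + a

theorem isometry_spanEmb (s : Finset E3) (a : E3) : Isometry (spanEmb s a) :=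
  (isometry_add_right a).comp isometry_subtype_coe

theorem isClosedEmbedding_spanEmb (s : Finset E3) (a : E3) :
    Topology.IsClosedEmbedding (spanEmb s a) :=
  (isometry_spanEmb s a).isClosedEmbedding

theorem hull_subset_range_spanEmb {s : Finset E3} {a : E3} (ha : a ∈ s) :
    hull s ⊆ Set.range (spanEmb s a) := fun x hx =>
  ⟨⟨x - a, vsub_mem_vectorSpan_of_mem_affineSpan_of_mem_affineSpan
    (convexHull_subset_affineSpan _ hx) (subset_affineSpan ℝ _ ha)⟩, by simp [spanEmb]⟩

theorem Bary.proj_spanEmb {s : Finset E3} (B : Bary s) {a : E3} (ha : a ∈ s)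
    (w : vectorSpan ℝ (s : Set E3)) : B.proj (spanEmb s a w) = spanEmb s a w := by
  have h1 : ∀ b ∈ s, B.proj b = b := fun b hb => by
    rw [Bary.proj, Finset.sum_eq_single_of_mem b hb, B.coord_self b hb, one_smul]
    intro c hc hcb
    rw [B.coord_ne c hc b hb hcb, zero_smul]
  have h2 : ∀ v ∈ vectorSpan ℝ (s : Set E3), ∑ c ∈ s, (B.coord c).linear v • c = v := by
    intro v hv
    induction hv using Submodule.span_induction with
    | mem v hv =>
      obtain ⟨b, hb, c, hc, rfl⟩ := hv
      simp only [vsub_eq_sub, Bary.linear_sub, sub_smul, Finset.sum_sub_distrib]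
      have hb' := h1 b hb
      have hc' := h1 c hc
      rw [Bary.proj] at hb' hc'
      rw [hb', hc']
    | zero => simp
    | add u v _ _ hu hv => simp only [map_add, add_smul, Finset.sum_add_distrib, hu, hv]
    | smul c v _ hv => simp only [map_smul, smul_assoc, ← Finset.smul_sum, hv]
  have h3 : ∀ c, B.coord c (spanEmb s a w) = (B.coord c).linear w + B.coord c a := fun c => by
    have := Bary.linear_sub (B.coord c) (spanEmb s a w) a
    rw [spanEmb, add_sub_cancel_right] at this
    rw [spanEmb, this]; ring
  have h4 := h1 a ha
  rw [Bary.proj] at h4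
  simp only [Bary.proj, h3, add_smul, Finset.sum_add_distrib, h2 w w.2, h4]
  rfl

section Measure

variable {s : Finset E3} {d : ℕ}

theorem finrank_vectorSpan_coe (hs : AffineIndependent ℝ ((↑) : s → E3)) (hd : s.card = d + 1) :
    Module.finrank ℝ (vectorSpan ℝ (s : Set E3)) = d := by
  have := hs.finrank_vectorSpan (n := d) (by simpa using hd)
  rwa [Subtype.range_coe_subtype, Finset.setOfPred_mem] at this

theorem measure_hull_lt_top (hs : AffineIndependent ℝ ((↑) : s → E3)) (hd : s.card = d + 1) :
    (μHE[d] : Measure E3) (hull s) < ⊤ := by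
  obtain rfl := finrank_vectorSpan_coe hs hd
  obtain ⟨a, ha⟩ : s.Nonempty := Finset.card_pos.1 (by omega)
  rw [← Set.image_preimage_eq_of_subset (hull_subset_range_spanEmb ha),
    (isometry_spanEmb s a).euclideanHausdorffMeasure_image]
  exact ((isClosedEmbedding_spanEmb s a).isCompact_preimage (isCompact_hull s)).measure_lt_top

theorem integrableOn_hull (hs : AffineIndependent ℝ ((↑) : s → E3)) (hd : s.card = d + 1)
    {h : E3 → ℝ} (hc : Continuous h) : IntegrableOn h (hull s) (μHE[d] : Measure E3) := by
  obtain ⟨M, hM⟩ := (isCompact_hull s).exists_bound_of_continuousOn hc.continuousOn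
  exact IntegrableOn.of_bound (measure_hull_lt_top hs hd) hc.aestronglyMeasurable M
    (ae_restrict_of_forall_mem (isCompact_hull s).measurableSet hM)

/-- Integrals over a simplex as integrals over a compact set in the direction of its affine span,
where the Hausdorff measure is a Haar measure. -/
theorem setIntegral_hull (hs : AffineIndependent ℝ ((↑) : s → E3)) (hd : s.card = d + 1)
    {a : E3} (ha : a ∈ s) (h : E3 → ℝ) : ∫ x in hull s, h x ∂(μHE[d] : Measure E3) =
      ∫ w in spanEmb s a ⁻¹' hull s, h (spanEmb s a w)
        ∂(μHE[Module.finrank ℝ (vectorSpan ℝ (s : Set E3))] : Measure _) := by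
  have hm := (isClosedEmbedding_spanEmb s a).measurableEmbedding
  rw [finrank_vectorSpan_coe hs hd, ← hm.setIntegral_map,
    (isometry_spanEmb s a).map_euclideanHausdorffMeasure, Measure.restrict_restrict
    (isCompact_hull s).measurableSet, Set.inter_eq_self_of_subset_left
    (hull_subset_range_spanEmb ha)]

/-- A continuous nonnegative function with vanishing integral over a simplex vanishes at the points
with positive barycentric coordinates. -/
theorem eq_zero_of_setIntegral_hull_eq_zero (B : Bary s)
    (hs : AffineIndependent ℝ ((↑) : s → E3)) (hd : s.card = d + 1) {h : E3 → ℝ}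
    (hc : Continuous h) (h0 : ∀ x ∈ hull s, 0 ≤ h x)
    (hi : ∫ x in hull s, h x ∂(μHE[d] : Measure E3) = 0) {w : E3 → ℝ} (hw0 : ∀ a ∈ s, 0 < w a)
    (hw : ∑ a ∈ s, w a = 1) : h (∑ a ∈ s, w a • a) = 0 := by
  obtain ⟨a, ha⟩ : s.Nonempty := Finset.card_pos.1 (by omega)
  have hφ := isClosedEmbedding_spanEmb s a
  rw [setIntegral_hull hs hd ha] at hi
  set C := spanEmb s a ⁻¹' hull s with hC
  set U := {v | ∀ b ∈ s, 0 < B.coord b (spanEmb s a v)} with hU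
  have hUC : U ⊆ C := fun v hv => mem_hull_iff.2
    ⟨fun b => B.coord b (spanEmb s a v), fun b hb => (hv b hb).le, B.sum_coord _,
      B.proj_spanEmb ha v⟩
  have hUo : IsOpen U := by
    have : U = ⋂ b ∈ s, {v | 0 < B.coord b (spanEmb s a v)} := by ext; simp [hU]
    rw [this]
    refine isOpen_biInter_finset fun b _ => isOpen_lt continuous_const ?_
    exact (AffineMap.continuous_of_finiteDimensional _).comp hφ.continuous
  have hCc : IsCompact C := hφ.isCompact_preimage (isCompact_hull s)
  have hcont : Continuous fun v => h (spanEmb s a v) := hc.comp hφ.continuous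
  rw [setIntegral_eq_zero_iff_of_nonneg_ae] at hi
  · have h1 := Measure.eqOn_open_of_ae_eq (ae_restrict_of_ae_restrict_of_subset hUC hi) hUo
      hcont.continuousOn continuousOn_const
    obtain ⟨v, hv⟩ := hull_subset_range_spanEmb ha
      (mem_hull_iff.2 ⟨w, fun b hb => (hw0 b hb).le, hw, rfl⟩)
    have h2 := h1 (x := v) fun b hb => by
      rw [hv, B.coord_sum_smul hw hb]
      exact hw0 b hb
    simpa [hv] using h2
  · exact ae_restrict_of_forall_mem hCc.measurableSet fun v hv => h0 _ hv
  · exact hcont.continuousOn.integrableOn_compact hCc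

end Measure

theorem exists_line_polynomial (x y : E3) (p : Poly) :
    ∃ P : Polynomial ℝ, ∀ t : ℝ, P.eval t = ev (x + t • y) p := by
  refine ⟨aeval (fun i => Polynomial.C (x i) + Polynomial.X * Polynomial.C (y i)) p, fun t => ?_⟩
  induction p using MvPolynomial.induction_on with
  | C r => simp [ev]
  | add p q hp hq => rw [map_add, Polynomial.eval_add, hp, hq, ev, ev, ev, map_add]
  | mul_X p i hp =>
    rw [map_mul, Polynomial.eval_mul, hp, ev, ev, map_mul]
    simp only [aeval_X, Polynomial.eval_add, Polynomial.eval_C, Polynomial.eval_mul,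
      Polynomial.eval_X, eval_X]
    rfl

/-- A polynomial that vanishes at the points of a simplex with positive barycentric coordinates
vanishes on its affine span. -/
theorem vanishes_of_pos {s : Finset E3} {p : Poly}
    (h : ∀ w : E3 → ℝ, (∀ a ∈ s, 0 < w a) → ∑ a ∈ s, w a = 1 → ev (∑ a ∈ s, w a • a) p = 0) :
    Vanishes s p := by
  intro w hw
  have hs : s.Nonempty := by
    rw [Finset.nonempty_iff_ne_empty]; rintro rfl; simp at hw
  have hc : (0 : ℝ) < s.card := by exact_mod_cast hs.card_pos
  -- the restriction of `p` to the line through the barycentre and the given point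
  obtain ⟨P, hP⟩ := exists_line_polynomial (∑ a ∈ s, (s.card : ℝ)⁻¹ • a)
    (∑ a ∈ s, (w a - (s.card : ℝ)⁻¹) • a) p
  have hPe : ∀ t : ℝ, P.eval t =
      ev (∑ a ∈ s, ((s.card : ℝ)⁻¹ + t * (w a - (s.card : ℝ)⁻¹)) • a) p := by
    intro t
    simp only [hP, add_smul, mul_smul, Finset.sum_add_distrib, Finset.smul_sum]
  have hsum : ∀ t : ℝ, ∑ a ∈ s, ((s.card : ℝ)⁻¹ + t * (w a - (s.card : ℝ)⁻¹)) = 1 := by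
    intro t
    rw [Finset.sum_add_distrib, ← Finset.mul_sum, Finset.sum_sub_distrib, hw, Finset.sum_const,
      nsmul_eq_mul, mul_inv_cancel₀ hc.ne']
    ring
  have hev : ∀ᶠ t in nhds (0 : ℝ), ∀ a ∈ s, 0 < (s.card : ℝ)⁻¹ + t * (w a - (s.card : ℝ)⁻¹) := by
    rw [Filter.eventually_all_finset]
    intro a _
    have : Continuous fun t : ℝ => (s.card : ℝ)⁻¹ + t * (w a - (s.card : ℝ)⁻¹) := by fun_prop
    exact this.continuousAt.eventually_const_lt (by simpa using hc)
  have hP0 : P = 0 := by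
    refine Polynomial.eq_zero_of_infinite_isRoot _ (Set.Infinite.mono (fun t ht => ?_)
      (infinite_of_mem_nhds (0 : ℝ) hev))
    rw [Set.mem_ofPred_eq, Polynomial.IsRoot, hPe]
    exact h _ ht (hsum t)
  have := hPe 1
  rw [hP0] at this
  simpa using this.symm

/-! ### Vanishing moments -/

/-- All moments of `g` on `s` of degree at most `m` vanish. -/
def ZeroMoments (d : ℕ) (m : ℤ) (s : Finset E3) (g : Poly) : Prop :=
  ∀ q ∈ polyLE m, ∫ x in hull s, ev x g * ev x q ∂(μHE[d] : Measure E3) = 0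

theorem hull_proj {s : Finset E3} (B : Bary s) {x : E3} (hx : x ∈ hull s) : B.proj x = x := by
  obtain ⟨w, -, hw, rfl⟩ := mem_hull_iff.1 hx
  exact B.proj_sum_smul hw

theorem ev_mul (x : E3) (p q : Poly) : ev x (p * q) = ev x p * ev x q := map_mul _ _ _

/-- Let `g` vanish to order `k` on the facets of the simplex `s`. If the degree of `g` is at most
`m + k |s|` and the moments of degree at most `m` vanish, then `g` vanishes on `s`: along `s`, `g`
is the product of a bubble `∏ μ_a ^ k` and a polynomial of degree at most `m`, which serves as test
function. -/
theorem vanishes_of_zeroMoments {s : Finset E3} {d : ℕ} (B : Bary s)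
    (hs : AffineIndependent ℝ ((↑) : s → E3)) (hd : s.card = d + 1) (hd1 : 1 ≤ d) {k : ℕ}
    {m M : ℤ} (hM : M ≤ m + k * s.card) {g : Poly} (hg : g ∈ polyLE M)
    (hdvd : ∀ a ∈ s, affPoly (B.coord a) ^ k ∣ B.pull g) (hmom : ZeroMoments d m s g) :
    Vanishes s g := by
  have hs1 : 1 < s.card := by omega
  obtain ⟨q, hq⟩ := B.prod_pow_dvd hs1 hdvd
  set b := ∏ a ∈ s, affPoly (B.coord a) ^ k with hb
  have hqm : q ∈ polyLE m := by
    have h1 := B.pull_mem_polyLE hg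
    rw [hq] at h1
    have h2 := mem_degLE_of_mul (B.prod_pow_ne_zero hs1 k) h1
    rw [B.totalDegree_prod_pow hs1 k] at h2
    exact degLE_mono (by push_cast; linarith) h2
  have hbe : ∀ x, ev x b = ∏ a ∈ s, B.coord a x ^ k := fun x => by
    rw [hb, ev, map_prod]
    refine Finset.prod_congr rfl fun a _ => ?_
    rw [map_pow]
    congr 1
    exact ev_affPoly _ _
  have hge : ∀ x, B.proj x = x → ev x g = ev x b * ev x q := fun x hx => by
    conv_lhs => rw [← hx, ← B.ev_pull, hq, ev_mul]
  refine vanishes_of_pos fun w hw0 hw => ?_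
  have hx : B.proj (∑ a ∈ s, w a • a) = ∑ a ∈ s, w a • a := B.proj_sum_smul hw
  have h1 := eq_zero_of_setIntegral_hull_eq_zero B hs hd (h := fun x => ev x b * (ev x q) ^ 2)
    ((continuous_ev b).mul ((continuous_ev q).pow 2))
    (fun x hx => mul_nonneg (by
      rw [hbe]
      exact Finset.prod_nonneg fun a ha => pow_nonneg (B.coord_nonneg hx ha) _) (sq_nonneg _))
    (by
      rw [← hmom q hqm]
      refine setIntegral_congr_fun (isCompact_hull s).measurableSet fun x hx => ?_
      rw [hge x (hull_proj B hx)]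
      ring) hw0 hw
  rw [hge _ hx]
  rcases mul_eq_zero.1 h1 with h | h
  · rw [h, zero_mul]
  · rw [pow_eq_zero_iff two_ne_zero] at h
    rw [h, mul_zero]


/-! ### Vanishing degrees of freedom on edges and faces -/

/-- The vertex degrees of freedom of `v` at `a` vanish. -/
structure ZeroVertexDofs (a : E3) (v : VecPoly) : Prop where
  val : ∀ i, ev a (v i) = 0
  grad : ∀ i j, ev a (pderiv j (v i)) = 0
  hess : ∀ i j l, ev a (pderiv j (pderiv l (v i))) = 0
  hessDiv : ∀ j l, ev a (pderiv j (pderiv l (divP v))) = 0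

/-- The degrees of freedom of `v` on the edge `e` vanish. -/
structure ZeroEdgeDofs (k : ℕ) (e : Finset E3) (F : EdgeFrame) (v : VecPoly) : Prop where
  val : ∀ i, ZeroMoments 1 ((k : ℤ) - 4) e (v i)
  div : ZeroMoments 1 ((k : ℤ) - 5) e (divP v)
  np_np : ZeroMoments 1 ((k : ℤ) - 3) e (dirDeriv F.np (dotP v F.np))
  np_nm : ZeroMoments 1 ((k : ℤ) - 3) e (dirDeriv F.nm (dotP v F.np))
  t_np : ZeroMoments 1 ((k : ℤ) - 3) e (dirDeriv F.np (dotP v F.t))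
  t_nm : ZeroMoments 1 ((k : ℤ) - 3) e (dirDeriv F.nm (dotP v F.t))
  nm_np : ZeroMoments 1 ((k : ℤ) - 3) e (dirDeriv F.np (dotP v F.nm))
  div_np : ZeroMoments 1 ((k : ℤ) - 4) e (dirDeriv F.np (divP v))
  div_nm : ZeroMoments 1 ((k : ℤ) - 4) e (dirDeriv F.nm (divP v))

/-- The degrees of freedom of `v` on the face `f` vanish. -/
structure ZeroFaceDofs (k : ℕ) (f : Finset E3) (v : VecPoly) : Prop where
  val : ∀ i, ZeroMoments 2 ((k : ℤ) - 4) f (v i)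
  div : ZeroMoments 2 ((k : ℤ) - 5) f (divP v)

theorem IsTetrahedron.affineIndependent {K s : Finset E3} (hK : IsTetrahedron K) (hs : s ⊆ K) :
    AffineIndependent ℝ ((↑) : s → E3) :=
  hK.indep.mono (by exact_mod_cast hs)

theorem ev_dirDeriv (x n : E3) (p : Poly) :
    ev x (dirDeriv n p) = ∑ j, n j * ev x (pderiv j p) := by
  simp [ev, dirDeriv]

theorem pderiv_dirDeriv (n : E3) (j : Fin 3) (p : Poly) :
    pderiv j (dirDeriv n p) = ∑ l, C (n l) * pderiv j (pderiv l p) := by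
  simp [dirDeriv]

theorem ev_pderiv_dirDeriv (x n : E3) (j : Fin 3) (p : Poly) :
    ev x (pderiv j (dirDeriv n p)) = ∑ l, n l * ev x (pderiv j (pderiv l p)) := by
  simp [pderiv_dirDeriv, ev]

theorem ev_pderiv_dotP (x m : E3) (j : Fin 3) (v : VecPoly) :
    ev x (pderiv j (dotP v m)) = ∑ i, m i * ev x (pderiv j (v i)) := by
  simp [ev, dotP]

theorem ev_pderiv_pderiv_dotP (x m : E3) (j l : Fin 3) (v : VecPoly) :
    ev x (pderiv j (pderiv l (dotP v m))) = ∑ i, m i * ev x (pderiv j (pderiv l (v i))) := by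
  simp [ev, dotP]

theorem ev_divP (x : E3) (v : VecPoly) : ev x (divP v) = ∑ i, ev x (pderiv i (v i)) := by
  simp [ev, divP]

theorem ev_pderiv_divP (x : E3) (j : Fin 3) (v : VecPoly) :
    ev x (pderiv j (divP v)) = ∑ i, ev x (pderiv j (pderiv i (v i))) := by
  simp [ev, divP]

theorem C_mul_mem_polyLE {m : ℤ} (c : ℝ) {p : Poly} (hp : p ∈ polyLE m) : C c * p ∈ polyLE m := by
  rw [← smul_eq_C_mul]
  exact Submodule.smul_mem _ c hp

theorem dirDeriv_mem_polyLE {m : ℤ} (n : E3) {p : Poly} (hp : p ∈ polyLE m) :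
    dirDeriv n p ∈ polyLE (m - 1) :=
  Submodule.sum_mem _ fun j _ => C_mul_mem_polyLE _ (pderiv_mem_degLE j hp)

theorem mem_vecPolyLE {m : ℤ} {v : VecPoly} : v ∈ vecPolyLE m ↔ ∀ i, v i ∈ polyLE m := by
  simp [vecPolyLE, Submodule.mem_pi]

theorem dotP_mem_polyLE {m : ℤ} (n : E3) {v : VecPoly} (hv : v ∈ vecPolyLE m) :
    dotP v n ∈ polyLE m :=
  Submodule.sum_mem _ fun i _ => C_mul_mem_polyLE _ (mem_vecPolyLE.1 hv i)

theorem divP_mem_polyLE {m : ℤ} {v : VecPoly} (hv : v ∈ vecPolyLE m) :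
    divP v ∈ polyLE (m - 1) :=
  Submodule.sum_mem _ fun i _ => pderiv_mem_degLE i (mem_vecPolyLE.1 hv i)

theorem Vanishes.dirDeriv_of_pderiv {s : Finset E3} {p : Poly}
    (h : ∀ j, Vanishes s (pderiv j p)) (n : E3) : Vanishes s (dirDeriv n p) := fun w hw => by
  rw [ev_dirDeriv]
  exact Finset.sum_eq_zero fun j _ => by rw [h j w hw, mul_zero]

theorem Vanishes.dirDeriv {s : Finset E3} (B : Bary s) {p : Poly} (h : Vanishes s p) {n : E3}
    (hn : n ∈ vectorSpan ℝ (s : Set E3)) : Vanishes s (dirDeriv n p) := by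
  induction hn using Submodule.span_induction with
  | mem v hv =>
    obtain ⟨a, ha, b, hb, rfl⟩ := hv
    rw [B.vanishes_iff_pull_eq_zero] at h ⊢
    beta_reduce
    rw [vsub_eq_sub, B.pull_dirDeriv ha hb, h]
    simp [TetElement.dirDeriv]
  | zero => intro w _; simp [ev_dirDeriv]
  | add u v _ _ hu hv =>
    intro w hw
    have hu := hu w hw
    have hv := hv w hw
    rw [ev_dirDeriv] at hu hv ⊢
    simp only [PiLp.add_apply, add_mul, Finset.sum_add_distrib, hu, hv, add_zero]
  | smul c v _ hv =>
    intro w hw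
    have hv := hv w hw
    rw [ev_dirDeriv] at hv ⊢
    simp only [PiLp.smul_apply, smul_eq_mul, mul_assoc, ← Finset.mul_sum, hv, mul_zero]

/-! #### Edges -/

theorem vanishes_edge {K e : Finset E3} (hK : IsTetrahedron K) (he : e ⊆ K) (hc : e.card = 2)
    {g : Poly} {M m : ℤ} {k : ℕ} (hg : g ∈ polyLE M) (hM : M ≤ m + 2 * k)
    (hvert : ∀ a ∈ e, ∀ τ, ∀ j < k, ev a ((dirDeriv τ)^[j] g) = 0)
    (hmom : ZeroMoments 1 m e g) : Vanishes e g := by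
  classical
  have hne : e.Nonempty := Finset.card_pos.1 (by omega)
  refine vanishes_of_zeroMoments (hK.subBary he hne) (hK.affineIndependent he) (by omega) le_rfl
    (k := k) (by rw [hc]; push_cast; linarith) hg (fun a ha => ?_) hmom
  obtain ⟨b, hb⟩ : ∃ b, e.erase a = {b} := Finset.card_eq_one.1 (by
    rw [Finset.card_erase_of_mem ha, hc])
  obtain ⟨hba, hbe⟩ := Finset.mem_erase.1 (hb ▸ Finset.mem_singleton_self b)
  refine Bary.pow_dvd_pull _ ha hbe hba.symm fun j hj => ?_
  rw [hb]
  intro w hw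
  rw [Finset.sum_singleton] at hw ⊢
  rw [hw, one_smul]
  exact hvert b hbe _ j hj

theorem iterate_dirDeriv_of_lt_two {a : E3} {g : Poly} (h0 : ev a g = 0)
    (h1 : ∀ j, ev a (pderiv j g) = 0) (τ : E3) (j : ℕ) (hj : j < 2) :
    ev a ((dirDeriv τ)^[j] g) = 0 := by
  interval_cases j
  · simpa using h0
  · simp [ev_dirDeriv, h1]

theorem iterate_dirDeriv_of_lt_three {a : E3} {g : Poly} (h0 : ev a g = 0)
    (h1 : ∀ j, ev a (pderiv j g) = 0) (h2 : ∀ j l, ev a (pderiv j (pderiv l g)) = 0) (τ : E3)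
    (j : ℕ) (hj : j < 3) : ev a ((dirDeriv τ)^[j] g) = 0 := by
  interval_cases j
  · simpa using h0
  · simp [ev_dirDeriv, h1]
  · simp [ev_dirDeriv, ev_pderiv_dirDeriv, h2]

theorem EdgeFrame.IsAdapted.linearIndependent {F : EdgeFrame} {e : Finset E3}
    (hF : F.IsAdapted e) : LinearIndependent ℝ ![F.t.ofLp, F.np.ofLp, F.nm.ofLp] := by
  have h1 : LinearIndependent ℝ ![F.t, F.np, F.nm] := by
    refine linearIndependent_finCons.2 ⟨hF.indep, fun h => ?_⟩
    have h2 : Submodule.span ℝ (Set.range ![F.np, F.nm]) ≤ (vectorSpan ℝ (e : Set E3))ᗮ := by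
      rw [Submodule.span_le]
      rintro _ ⟨i, rfl⟩
      fin_cases i
      · exact hF.normal_np
      · exact hF.normal_nm
    have h3 := Submodule.inner_right_of_mem_orthogonal hF.tangent (h2 h)
    rw [inner_self_eq_zero] at h3
    simpa [h3] using hF.norm_t
  have h2 := h1.map' (WithLp.linearEquiv 2 ℝ (Fin 3 → ℝ)).toLinearMap
    (LinearEquiv.ker _)
  have h3 : ![F.t.ofLp, F.np.ofLp, F.nm.ofLp] =
      (WithLp.linearEquiv 2 ℝ (Fin 3 → ℝ)).toLinearMap ∘ ![F.t, F.np, F.nm] := by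
    ext i : 1
    fin_cases i <;> rfl
  rw [h3]
  exact h2

theorem eq_zero_of_dotProduct_eq_zero {b : Fin 3 → Fin 3 → ℝ} (hb : LinearIndependent ℝ b)
    {w : Fin 3 → ℝ} (h : ∀ i, b i ⬝ᵥ w = 0) : w = 0 := by
  have hspan : Submodule.span ℝ (Set.range b) = ⊤ := hb.span_eq_top_of_card_eq_finrank' (by simp)
  have : ∀ u ∈ Submodule.span ℝ (Set.range b), u ⬝ᵥ w = 0 := fun u hu => by
    induction hu using Submodule.span_induction with
    | mem u hu => obtain ⟨i, rfl⟩ := hu; exact h i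
    | zero => simp
    | add u v _ _ hu hv => rw [add_dotProduct, hu, hv, add_zero]
    | smul c u _ hu => rw [smul_dotProduct, hu, smul_zero]
  exact dotProduct_self_eq_zero.1 (this w (hspan ▸ Submodule.mem_top))

/-- A trace-free `3 × 3` matrix `A` with `A t = 0` and `mᵀ A n = 0` for all pairs `(m, n)` from
`(t, p, q)` with `n ≠ t`, except possibly for `m = n = q`, vanishes if `(t, p, q)` is a basis:
`A q` has no `q`-component since the trace is zero, and is orthogonal to `t` and `p`. -/
theorem matrix_eq_zero_of_trace_eq_zero {A : Matrix (Fin 3) (Fin 3) ℝ} {t p q : Fin 3 → ℝ}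
    (hb : LinearIndependent ℝ ![t, p, q]) (ht : A.mulVec t = 0)
    (hpp : p ⬝ᵥ A.mulVec p = 0) (htp : t ⬝ᵥ A.mulVec p = 0) (hqp : q ⬝ᵥ A.mulVec p = 0)
    (hpq : p ⬝ᵥ A.mulVec q = 0) (htq : t ⬝ᵥ A.mulVec q = 0) (htr : A.trace = 0) : A = 0 := by
  have hp : A.mulVec p = 0 := eq_zero_of_dotProduct_eq_zero hb fun i => by
    fin_cases i
    exacts [htp, hpp, hqp]
  set b := basisOfLinearIndependentOfCardEqFinrank hb (by simp) with hbdef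
  have hb' : ⇑b = ![t, p, q] := coe_basisOfLinearIndependentOfCardEqFinrank hb _
  have htr' : b.repr (A.mulVec q) 2 = 0 := by
    have h1 : LinearMap.trace ℝ _ (Matrix.toLin' A) = 0 := by
      rw [Matrix.trace_toLin'_eq, htr]
    rw [LinearMap.trace_eq_matrix_trace ℝ b, Matrix.trace] at h1
    simpa [Fin.sum_univ_three, LinearMap.toMatrix_apply, hb', ht, hp] using h1
  have hq : A.mulVec q = 0 := by
    have h1 := b.sum_repr (A.mulVec q)
    rw [Fin.sum_univ_three, htr', hb'] at h1
    simp only [Matrix.cons_val, zero_smul, add_zero] at h1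
    refine dotProduct_self_eq_zero.1 ?_
    conv_lhs =>
      arg 1
      rw [← h1]
    rw [add_dotProduct, smul_dotProduct, smul_dotProduct, htq, hpq]
    simp
  refine Matrix.toLin'.injective (b.ext fun i => ?_)
  rw [hb']
  fin_cases i
  · simpa using ht
  · simpa using hp
  · simpa using hq

/-- `v`, `∇v`, `div v` and `∇(div v)` vanish on `s`. -/
structure Flat (s : Finset E3) (v : VecPoly) : Prop where
  val : ∀ i, Vanishes s (v i)
  grad : ∀ i j, Vanishes s (pderiv j (v i))
  div : Vanishes s (divP v)
  gradDiv : ∀ j, Vanishes s (pderiv j (divP v))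

/-- The edge and vertex degrees of freedom determine the field, its gradient, its divergence and
the gradient of its divergence on an edge. -/
theorem flat_edge {k : ℕ} {K e : Finset E3} (hK : IsTetrahedron K) (he : e ⊆ K) (hc : e.card = 2)
    {F : EdgeFrame} (hF : F.IsAdapted e) {v : VecPoly} (hv : v ∈ vecPolyLE ((k : ℤ) + 2))
    (hvert : ∀ a ∈ e, ZeroVertexDofs a v) (hedge : ZeroEdgeDofs k e F v) : Flat e v := by
  have hne : e.Nonempty := Finset.card_pos.1 (by omega)
  have B := hK.subBary he hne
  have hdivm := divP_mem_polyLE hv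
  have hval : ∀ i, Vanishes e (v i) := fun i =>
    vanishes_edge hK he hc (mem_vecPolyLE.1 hv i) (k := 3) (by push_cast; linarith)
      (fun a ha => iterate_dirDeriv_of_lt_three ((hvert a ha).val i) ((hvert a ha).grad i)
        ((hvert a ha).hess i)) (hedge.val i)
  have hdiv0 : ∀ a ∈ e, ev a (divP v) = 0 := fun a ha => by simp [ev_divP, (hvert a ha).grad]
  have hdiv1 : ∀ a ∈ e, ∀ j, ev a (pderiv j (divP v)) = 0 := fun a ha j => by
    simp [ev_pderiv_divP, (hvert a ha).hess]
  have hdiv : Vanishes e (divP v) :=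
    vanishes_edge hK he hc hdivm (k := 3) (by push_cast; linarith)
      (fun a ha => iterate_dirDeriv_of_lt_three (hdiv0 a ha) (hdiv1 a ha) (hvert a ha).hessDiv)
      hedge.div
  have hmixed : ∀ m n : E3, ZeroMoments 1 ((k : ℤ) - 3) e (dirDeriv n (dotP v m)) →
      Vanishes e (dirDeriv n (dotP v m)) := fun m n h =>
    vanishes_edge hK he hc (dirDeriv_mem_polyLE n (dotP_mem_polyLE m hv)) (k := 2)
      (by push_cast; linarith)
      (fun a ha => iterate_dirDeriv_of_lt_two
        (by simp [ev_dirDeriv, ev_pderiv_dotP, (hvert a ha).grad])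
        fun j => by simp [ev_pderiv_dirDeriv, ev_pderiv_pderiv_dotP, (hvert a ha).hess]) h
  have hnorm : ∀ n : E3, ZeroMoments 1 ((k : ℤ) - 4) e (dirDeriv n (divP v)) →
      Vanishes e (dirDeriv n (divP v)) := fun n h =>
    vanishes_edge hK he hc (dirDeriv_mem_polyLE n hdivm) (k := 2) (by push_cast; linarith)
      (fun a ha => iterate_dirDeriv_of_lt_two (by simp [ev_dirDeriv, hdiv1 a ha])
        fun j => by simp [ev_pderiv_dirDeriv, (hvert a ha).hessDiv]) h
  have hbasis := hF.linearIndependent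
  refine ⟨hval, fun i j w hw => ?_, hdiv, fun j w hw => ?_⟩
  · set x := ∑ a ∈ e, w a • a
    set A : Matrix (Fin 3) (Fin 3) ℝ := fun i j => ev x (pderiv j (v i)) with hA
    have hbil : ∀ m n : E3, Vanishes e (dirDeriv n (dotP v m)) →
        m.ofLp ⬝ᵥ A.mulVec n.ofLp = 0 := fun m n h => by
      rw [← h w hw, ev_dirDeriv]
      simp only [ev_pderiv_dotP, dotProduct, Matrix.mulVec, Finset.mul_sum, hA]
      rw [Finset.sum_comm]
      exact Finset.sum_congr rfl fun _ _ => Finset.sum_congr rfl fun _ _ => by ring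
    have hA0 : A = 0 := by
      refine matrix_eq_zero_of_trace_eq_zero hbasis ?_ (hbil _ _ (hmixed _ _ hedge.np_np))
        (hbil _ _ (hmixed _ _ hedge.t_np)) (hbil _ _ (hmixed _ _ hedge.nm_np))
        (hbil _ _ (hmixed _ _ hedge.np_nm)) (hbil _ _ (hmixed _ _ hedge.t_nm)) ?_
      · ext i
        have h1 := (hval i).dirDeriv B hF.tangent w hw
        rw [ev_dirDeriv] at h1
        simp only [Matrix.mulVec, dotProduct, hA, Pi.zero_apply]
        rw [← h1]
        exact Finset.sum_congr rfl fun _ _ => mul_comm _ _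
      · rw [← hdiv w hw, ev_divP]
        rfl
    exact congrFun (congrFun hA0 i) j
  · set x := ∑ a ∈ e, w a • a
    have h0 : (fun j => ev x (pderiv j (divP v))) = 0 :=
      eq_zero_of_dotProduct_eq_zero hbasis fun i => by
        have ht := hdiv.dirDeriv B hF.tangent w hw
        have hp := hnorm _ hedge.div_np w hw
        have hq := hnorm _ hedge.div_nm w hw
        rw [ev_dirDeriv] at ht hp hq
        fin_cases i
        exacts [ht, hp, hq]
    exact congrFun h0 j

/-! #### Faces -/

open Classical in
theorem vanishes_face {K f : Finset E3} (hK : IsTetrahedron K) (hf : f ⊆ K) (hc : f.card = 3)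
    {g : Poly} {M m : ℤ} (hg : g ∈ polyLE M) (hM : M ≤ m + 6)
    (h0 : ∀ a ∈ f, Vanishes (f.erase a) g) (h1 : ∀ a ∈ f, ∀ j, Vanishes (f.erase a) (pderiv j g))
    (hmom : ZeroMoments 2 m f g) : Vanishes f g := by
  have hne : f.Nonempty := Finset.card_pos.1 (by omega)
  refine vanishes_of_zeroMoments (hK.subBary hf hne) (hK.affineIndependent hf) (by omega)
    one_le_two (k := 2) (by rw [hc]; push_cast; linarith) hg (fun a ha => ?_) hmom
  obtain ⟨b, hb, hba⟩ := Finset.exists_mem_ne (by omega : 1 < f.card) a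
  refine Bary.pow_dvd_pull _ ha hb hba.symm fun j hj => ?_
  interval_cases j
  · exact h0 a ha
  · exact Vanishes.dirDeriv_of_pderiv (h1 a ha) _

open Classical in
/-- A field whose vertex, edge and face degrees of freedom on a face vanish is zero on this face,
and so is its divergence. -/
theorem vanishes_on_face {k : ℕ} {K f : Finset E3} (hK : IsTetrahedron K) (hf : f ⊆ K)
    (hc : f.card = 3) {v : VecPoly} (hv : v ∈ vecPolyLE ((k : ℤ) + 2))
    (hedge : ∀ e ⊆ f, e.card = 2 → Flat e v) (hface : ZeroFaceDofs k f v) :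
    (∀ i, Vanishes f (v i)) ∧ Vanishes f (divP v) := by
  have h : ∀ a ∈ f, Flat (f.erase a) v := fun a ha =>
    hedge _ (Finset.erase_subset _ _) (by rw [Finset.card_erase_of_mem ha, hc])
  exact ⟨fun i => vanishes_face hK hf hc (mem_vecPolyLE.1 hv i) (by linarith)
    (fun a ha => (h a ha).val i) (fun a ha => (h a ha).grad i) (hface.val i),
    vanishes_face hK hf hc (divP_mem_polyLE hv) (by linarith) (fun a ha => (h a ha).div)
    (fun a ha => (h a ha).gradDiv) hface.div⟩

/-! ### Fields without degrees of freedom -/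

/-- A field whose vertex, edge and face degrees of freedom vanish belongs to the bubble space. -/
theorem mem_divBubble {k : ℕ} {K : Finset E3} (hK : IsTetrahedron K) {v : VecPoly}
    (hv : v ∈ vecPolyLE ((k : ℤ) + 2))
    (hface : ∀ f ⊆ K, f.card = 3 → (∀ i, Vanishes f (v i)) ∧ Vanishes f (divP v)) :
    v ∈ divBubble k hK := by
  classical
  have hK1 : 1 < K.card := by rw [hK.card_eq]; norm_num
  have hcard : ∀ a ∈ K, (K.erase a).card = 3 := fun a ha => by
    rw [Finset.card_erase_of_mem ha, hK.card_eq]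
  have hdvd : ∀ i, ∏ a ∈ K, affPoly (hK.bary.coord a) ^ 1 ∣ v i := fun i => by
    refine hK.bary.prod_pow_dvd hK1 fun a ha => ?_
    obtain ⟨b, hb, hba⟩ := Finset.exists_mem_ne hK1 a
    rw [pow_one, ← hK.pull_bary (v i)]
    exact hK.bary.dvd_pull_of_vanishes ha hb hba.symm
      ((hface _ (Finset.erase_subset _ _) (hcard a ha)).1 i)
  choose p hp using hdvd
  refine ⟨⟨p, mem_vecPolyLE.2 fun i => ?_, fun x i => ?_⟩, fun f hf x hx => ?_⟩
  · have h1 := mem_vecPolyLE.1 hv i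
    rw [hp] at h1
    have h2 := mem_degLE_of_mul (hK.bary.prod_pow_ne_zero hK1 1) h1
    rw [hK.bary.totalDegree_prod_pow hK1 1, hK.card_eq] at h2
    exact degLE_mono (by push_cast; linarith) h2
  · rw [hp, ev_mul, ev, map_prod, ← Finset.prod_coe_sort]
    congr 1
    refine Finset.prod_congr rfl fun a _ => ?_
    rw [pow_one, hK.bary_coord]
    exact ev_affPoly _ _
  · rw [Finset.mem_powersetCard] at hf
    exact (hface f hf.1 hf.2).2.ev_eq_zero hx

/-- A field without degrees of freedom is orthogonal to itself, hence zero. -/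
theorem eq_zero_of_zeroDofs {k : ℕ} {K : Finset E3} (hK : IsTetrahedron K)
    {frame : Finset E3 → EdgeFrame} (hframe : ∀ e ∈ K.powersetCard 2, (frame e).IsAdapted e)
    {v : VecPoly} (hv : v ∈ vecPolyLE ((k : ℤ) + 2)) (hvert : ∀ a ∈ K, ZeroVertexDofs a v)
    (hedge : ∀ e ∈ K.powersetCard 2, ZeroEdgeDofs k e (frame e) v)
    (hface : ∀ f ∈ K.powersetCard 3, ZeroFaceDofs k f v)
    (hint : ∀ q ∈ divBubble k hK, ∫ x in hull K, ∑ i, ev x (v i) * ev x (q i) = 0) : v = 0 := by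
  have hE : ∀ e ⊆ K, e.card = 2 → Flat e v := fun e he hc =>
    have hm := Finset.mem_powersetCard.2 ⟨he, hc⟩
    flat_edge hK he hc (hframe e hm) hv (fun a ha => hvert a (he ha)) (hedge e hm)
  have hmem : v ∈ divBubble k hK := mem_divBubble hK hv fun f hf hc =>
    vanishes_on_face hK hf hc hv (fun e he => hE e (he.trans hf))
      (hface f (Finset.mem_powersetCard.2 ⟨hf, hc⟩))
  have h0 := hint v hmem
  rw [← EuclideanSpace.euclideanHausdorffMeasure_eq_volume 3] at h0
  ext1 i
  rw [Pi.zero_apply, ← hK.pull_bary (v i), ← hK.bary.vanishes_iff_pull_eq_zero]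
  refine vanishes_of_pos fun w hw0 hw => ?_
  have h1 := eq_zero_of_setIntegral_hull_eq_zero hK.bary hK.indep (d := 3) (by rw [hK.card_eq])
    (h := fun x => ∑ i, ev x (v i) * ev x (v i))
    (continuous_finsetSum _ fun i _ => (continuous_ev _).mul (continuous_ev _))
    (fun x _ => Finset.sum_nonneg fun i _ => mul_self_nonneg _) h0 hw0 hw
  rw [Finset.sum_eq_zero_iff_of_nonneg fun i _ => mul_self_nonneg _] at h1
  exact mul_self_eq_zero.1 (h1 i (Finset.mem_univ i))


/-! ### Differences of fields with equal degrees of freedom -/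

theorem ev_sub (x : E3) (p q : Poly) : ev x (p - q) = ev x p - ev x q := map_sub _ _ _

theorem ev_add (x : E3) (p q : Poly) : ev x (p + q) = ev x p + ev x q := map_add _ _ _

theorem ev_smul (x : E3) (c : ℝ) (p : Poly) : ev x (c • p) = c * ev x p := smul_eval _ _ _

/-- The divergence as a linear map. -/
def divL : VecPoly →ₗ[ℝ] Poly where
  toFun := divP
  map_add' v w := by simp [divP, Finset.sum_add_distrib]
  map_smul' c v := by simp [divP, Finset.smul_sum]

/-- The component in a given direction as a linear map. -/
def dotL (m : E3) : VecPoly →ₗ[ℝ] Poly where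
  toFun v := dotP v m
  map_add' v w := by simp [dotP, mul_add, Finset.sum_add_distrib]
  map_smul' c v := by simp [dotP, Finset.smul_sum]

/-- The directional derivative as a linear map. -/
def dirL (n : E3) : Poly →ₗ[ℝ] Poly where
  toFun := dirDeriv n
  map_add' := dirDeriv_add n
  map_smul' := dirDeriv_smul n

/-- Evaluation at a point as a linear map. -/
def evL (a : E3) : Poly →ₗ[ℝ] ℝ where
  toFun := ev a
  map_add' := ev_add a
  map_smul' := ev_smul a

theorem divP_sub (v w : VecPoly) : divP (v - w) = divP v - divP w := map_sub divL v w

theorem dirDeriv_dotP_sub (n m : E3) (v w : VecPoly) :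
    dirDeriv n (dotP (v - w) m) = dirDeriv n (dotP v m) - dirDeriv n (dotP w m) :=
  map_sub (dirL n ∘ₗ dotL m) v w

theorem dirDeriv_divP_sub (n : E3) (v w : VecPoly) :
    dirDeriv n (divP (v - w)) = dirDeriv n (divP v) - dirDeriv n (divP w) :=
  map_sub (dirL n ∘ₗ divL) v w

theorem HasVertexDofs.sub {a : E3} {v w : VecPoly} {D : VertexData} (hv : HasVertexDofs a v D)
    (hw : HasVertexDofs a w D) : ZeroVertexDofs a (v - w) where
  val i := by rw [Pi.sub_apply, ev_sub, hv.val, hw.val, sub_self]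
  grad i j := by rw [Pi.sub_apply, map_sub, ev_sub, hv.grad, hw.grad, sub_self]
  hess i j l := by rw [Pi.sub_apply, map_sub, map_sub, ev_sub, hv.hess, hw.hess, sub_self]
  hessDiv j l := by rw [divP_sub, map_sub, map_sub, ev_sub, hv.hessDiv, hw.hessDiv, sub_self]

section Moments

variable {s : Finset E3} {d : ℕ} {m : ℤ}

theorem integrable_ev_mul (hs : AffineIndependent ℝ ((↑) : s → E3)) (hd : s.card = d + 1)
    (p q : Poly) :
    Integrable (fun x => ev x p * ev x q) ((μHE[d] : Measure E3).restrict (hull s)) :=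
  integrableOn_hull hs hd ((continuous_ev p).mul (continuous_ev q))

theorem HasMoments.sub (hs : AffineIndependent ℝ ((↑) : s → E3)) (hd : s.card = d + 1)
    {g h : Poly} {ℓ : Module.Dual ℝ (PolyOn m s)} (hg : HasMoments d m s g ℓ)
    (hh : HasMoments d m s h ℓ) : ZeroMoments d m s (g - h) := fun q hq => by
  have h1 := hg ⟨q, hq⟩
  have h2 := hh ⟨q, hq⟩
  simp only [ev_sub, sub_mul]
  rw [integral_sub (integrable_ev_mul hs hd g q) (integrable_ev_mul hs hd h q), h1, h2, sub_self]

/-- Moments of a vector field are moments of its components. -/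
theorem hasVecMoments_iff (hs : AffineIndependent ℝ ((↑) : s → E3)) (hd : s.card = d + 1)
    {v : VecPoly} {ℓ : Module.Dual ℝ (Fin 3 → PolyOn m s)} :
    HasVecMoments d m s v ℓ ↔
      ∀ i, HasMoments d m s (v i) (ℓ ∘ₗ LinearMap.single ℝ (fun _ => PolyOn m s) i) := by
  constructor
  · intro h i q
    have h1 := h (Pi.single i q)
    have h2 : (fun j => onto m s (Pi.single (M := fun _ => polyLE m) i q j)) =
        Pi.single i (onto m s q) := by
      ext1 j
      exact Pi.apply_single (fun _ => onto m s) (fun _ => map_zero _) i q j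
    rw [h2] at h1
    rw [LinearMap.comp_apply, LinearMap.single_apply, ← h1]
    refine integral_congr_ae (Filter.Eventually.of_forall fun x => ?_)
    beta_reduce
    rw [Finset.sum_eq_single i]
    · simp
    · intro j _ hj
      simp [hj, ev]
    · simp
  · intro h q
    rw [integral_finsetSum _ fun i _ => integrable_ev_mul hs hd (v i) (q i)]
    have h1 : (fun i => onto m s (q i)) = ∑ i, Pi.single i (onto m s (q i)) :=
      (Finset.univ_sum_single _).symm
    rw [h1, map_sum]
    exact Finset.sum_congr rfl fun i _ => h i (q i)

theorem HasVecMoments.sub (hs : AffineIndependent ℝ ((↑) : s → E3)) (hd : s.card = d + 1)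
    {v w : VecPoly} {ℓ : Module.Dual ℝ (Fin 3 → PolyOn m s)} (hv : HasVecMoments d m s v ℓ)
    (hw : HasVecMoments d m s w ℓ) (i : Fin 3) : ZeroMoments d m s ((v - w) i) :=
  ((hasVecMoments_iff hs hd).1 hv i).sub hs hd ((hasVecMoments_iff hs hd).1 hw i)

end Moments

theorem HasEdgeDofs.sub {k : ℕ} {e : Finset E3} (he : AffineIndependent ℝ ((↑) : e → E3))
    (hc : e.card = 2) {F : EdgeFrame} {v w : VecPoly} {D : EdgeData k e}
    (hv : HasEdgeDofs k e F v D) (hw : HasEdgeDofs k e F w D) : ZeroEdgeDofs k e F (v - w) where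
  val := hv.val.sub he hc hw.val
  div := by rw [divP_sub]; exact hv.div.sub he hc hw.div
  np_np := by rw [dirDeriv_dotP_sub]; exact hv.np_np.sub he hc hw.np_np
  np_nm := by rw [dirDeriv_dotP_sub]; exact hv.np_nm.sub he hc hw.np_nm
  t_np := by rw [dirDeriv_dotP_sub]; exact hv.t_np.sub he hc hw.t_np
  t_nm := by rw [dirDeriv_dotP_sub]; exact hv.t_nm.sub he hc hw.t_nm
  nm_np := by rw [dirDeriv_dotP_sub]; exact hv.nm_np.sub he hc hw.nm_np
  div_np := by rw [dirDeriv_divP_sub]; exact hv.div_np.sub he hc hw.div_np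
  div_nm := by rw [dirDeriv_divP_sub]; exact hv.div_nm.sub he hc hw.div_nm

theorem HasFaceDofs.sub {k : ℕ} {f : Finset E3} (hf : AffineIndependent ℝ ((↑) : f → E3))
    (hc : f.card = 3) {v w : VecPoly} {D : FaceData k f} (hv : HasFaceDofs k f v D)
    (hw : HasFaceDofs k f w D) : ZeroFaceDofs k f (v - w) where
  val := hv.val.sub hf hc hw.val
  div := by rw [divP_sub]; exact hv.div.sub hf hc hw.div

theorem integrable_sum_ev_mul (K : Finset E3) (v w : VecPoly) :
    Integrable (fun x => ∑ i, ev x (v i) * ev x (w i)) (volume.restrict (hull K)) :=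
  (continuous_finsetSum _ fun i _ => (continuous_ev (v i)).mul
    (continuous_ev (w i))).continuousOn.integrableOn_compact (isCompact_hull K)

/-- The degrees of freedom determine a field of degree at most `k + 2`. -/
theorem HasDofs.unique {k : ℕ} {K : Finset E3} {hK : IsTetrahedron K}
    {frame : Finset E3 → EdgeFrame} (hframe : ∀ e ∈ K.powersetCard 2, (frame e).IsAdapted e)
    {v w : VecPoly} {D : DofData k hK} (hvm : v ∈ vecPolyLE ((k : ℤ) + 2))
    (hwm : w ∈ vecPolyLE ((k : ℤ) + 2)) (hv : HasDofs k hK frame v D)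
    (hw : HasDofs k hK frame w D) : v = w := by
  rw [← sub_eq_zero]
  refine eq_zero_of_zeroDofs hK hframe (Submodule.sub_mem _ hvm hwm)
    (fun a ha => (hv.vertex ⟨a, ha⟩).sub (hw.vertex ⟨a, ha⟩)) (fun e he => ?_) (fun f hf => ?_)
    fun q hq => ?_
  · have h := Finset.mem_powersetCard.1 he
    exact (hv.edge ⟨e, he⟩).sub (hK.affineIndependent h.1) h.2 (hw.edge ⟨e, he⟩)
  · have h := Finset.mem_powersetCard.1 hf
    exact (hv.face ⟨f, hf⟩).sub (hK.affineIndependent h.1) h.2 (hw.face ⟨f, hf⟩)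
  · have h1 := hv.interior ⟨q, hq⟩
    have h2 := hw.interior ⟨q, hq⟩
    simp only [Pi.sub_apply, ev_sub, sub_mul, Finset.sum_sub_distrib]
    rw [integral_sub (integrable_sum_ev_mul K v q) (integrable_sum_ev_mul K w q), h1, h2, sub_self]

/-! ### Dimensions -/

/-- The degree is written as `n - 1` so that the zero space of polynomials of degree at most `-1` is
included. -/
theorem finrank_degLE (d n : ℕ) :
    Module.finrank ℝ (degLE (d + 1) ((n : ℤ) - 1)) = (n + d).choose (d + 1) := by
  classical
  have h1 : {s : Fin (d + 1) →₀ ℕ | (s.degree : ℤ) ≤ (n : ℤ) - 1} =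
      ((Finset.range n).biUnion fun i => (Finset.univ : Finset (Fin (d + 1))).finsuppAntidiag i :
        Finset (Fin (d + 1) →₀ ℕ)) := by
    ext s
    simp only [Set.mem_ofPred_eq, Finset.coe_biUnion, Set.mem_iUnion, Finset.mem_coe,
      Finset.mem_range, Finset.mem_finsuppAntidiag, Finset.subset_univ, and_true]
    have h : s.degree = Finset.univ.sum ⇑s := Finsupp.degree_eq_sum s
    rw [← h]
    constructor
    · intro h
      exact ⟨_, by omega, rfl⟩
    · rintro ⟨i, hi, rfl⟩
      omega
  rw [degLE, Module.finrank_eq_nat_card_basis (basisRestrictSupport ℝ _), h1,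
    Nat.card_coe_set_eq, Set.ncard_coe_finset, Finset.card_biUnion]
  · simp only [Finset.card_finsuppAntidiag_nat_eq_choose, Finset.card_univ, Fintype.card_fin]
    induction n with
    | zero => simp
    | succ n ih =>
      have h2 : ∀ n, (d + 1 + n - 1).choose n = (n + d).choose d := fun n => by
        rw [show d + 1 + n - 1 = n + d by omega, ← Nat.choose_symm_add]
      rw [Finset.sum_range_succ, h2]
      have h3 : ∑ i ∈ Finset.range n, (d + 1 + i - 1).choose i = (n + d).choose (d + 1) := by
        clear ih h1
        induction n with
        | zero => simp
        | succ n ih => rw [Finset.sum_range_succ, h2, ih, Nat.add_right_comm, Nat.choose_succ_succ,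
            add_comm]
      rw [h3, Nat.add_right_comm, Nat.choose_succ_succ, add_comm]
  · intro i _ j _ hij
    rw [Function.onFun, Finset.disjoint_left]
    intro s hs hs'
    rw [Finset.mem_finsuppAntidiag] at hs hs'
    exact hij (hs.1.symm.trans hs'.1)

instance finite_polyOn (m : ℤ) (s : Finset E3) : Module.Finite ℝ (PolyOn m s) :=
  have : Module.Finite ℝ (polyLE m) := finite_degLE 3 m
  Module.Finite.range _

open Classical in
theorem Bary.apply_eq_add_sum {s : Finset E3} (B : Bary s) {r : E3} (hr : r ∈ s) {d : ℕ}
    (e : s.erase r ≃ Fin d) {x : E3} (hx : B.proj x = x) (i : Fin 3) :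
    x i = r i + ∑ j, ((e.symm j : E3) i - r i) * B.coord (e.symm j) x := by
  have h1 := B.sum_coord x
  have h2 : x i = (B.proj x) i := by rw [hx]
  have h3 : ∀ g : E3 → ℝ, ∑ a ∈ s.erase r, g a = ∑ j, g (e.symm j) := fun g => by
    rw [← Finset.sum_coe_sort]
    exact (Equiv.sum_comp e.symm fun a : s.erase r => g a).symm
  have h4 : (∑ a ∈ s.erase r, B.coord a x • a : E3) i =
      ∑ a ∈ s.erase r, B.coord a x * a i := by simp
  rw [← Finset.add_sum_erase _ _ hr, h3] at h1
  rw [Bary.proj, ← Finset.add_sum_erase _ _ hr, PiLp.add_apply, PiLp.smul_apply, smul_eq_mul, h4,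
    h3] at h2
  rw [h2, eq_sub_of_add_eq h1]
  simp only [sub_mul, Finset.sum_sub_distrib, ← Finset.mul_sum, mul_comm]
  ring

/-- A polynomial on a `d`-simplex is a polynomial in `d` of the barycentric coordinates. -/
theorem finrank_polyOn_le {K s : Finset E3} (hK : IsTetrahedron K) (hs : s ⊆ K) {d : ℕ}
    (hd : s.card = d + 1) (m : ℤ) :
    Module.finrank ℝ (PolyOn m s) ≤ Module.finrank ℝ (degLE d m) := by
  classical
  obtain ⟨r, hr⟩ : s.Nonempty := Finset.card_pos.1 (by omega)
  have B := hK.subBary hs ⟨r, hr⟩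
  have e : s.erase r ≃ Fin d := Finset.equivFinOfCardEq (by
    rw [Finset.card_erase_of_mem hr, hd, Nat.add_sub_cancel])
  let T : degLE d m →ₗ[ℝ] (hull s → ℝ) :=
    { toFun := fun Q x => eval (fun j => B.coord (e.symm j) x) Q.1
      map_add' := fun Q R => by ext x; simp
      map_smul' := fun a Q => by ext x; simp }
  have hT : PolyOn m s ≤ LinearMap.range T := by
    rintro _ ⟨⟨g, hg⟩, rfl⟩
    have hG : (aeval (fun i => C (r i) + ∑ j, C ((e.symm j : E3) i - r i) * X j) g :
        MvPolynomial (Fin d) ℝ) ∈ degLE d m :=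
      aeval_mem_degLE (fun i => Submodule.add_mem _ (C_mem_degLE zero_le_one _)
        (Submodule.sum_mem _ fun j _ => by
          rw [← smul_eq_C_mul]
          exact Submodule.smul_mem _ _ (X_mem_degLE j))) hg
    refine ⟨⟨_, hG⟩, ?_⟩
    ext ⟨x, hx⟩
    change eval _ (aeval _ g) = eval x.ofLp g
    rw [eval_aeval]
    congr 2
    ext i
    rw [B.apply_eq_add_sum hr e (hull_proj B hx) i]
    simp
  exact (Submodule.finrank_mono hT).trans (LinearMap.finrank_range_le T)


/-! ### The dimension of the bubble space -/

theorem sum_smul_apply (s : Finset E3) (w : E3 → ℝ) (i : Fin 3) :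
    (∑ a ∈ s, w a • a : E3) i = ∑ a ∈ s, w a * a i := by
  simp

section Bubble

variable {K : Finset E3} (hK : IsTetrahedron K)

/-- The barycentric coordinates of a tetrahedron as polynomials. -/
def IsTetrahedron.lam (a : E3) : Poly := affPoly (hK.bary.coord a)

/-- The `i`-th component of the gradient of a barycentric coordinate. -/
def IsTetrahedron.gradLam (a : E3) (i : Fin 3) : ℝ :=
  (hK.bary.coord a).linear (EuclideanSpace.single i 1)

theorem IsTetrahedron.gradLam_eq (a : E3) (i : Fin 3) : hK.gradLam a i =
    hK.bary.coord a (EuclideanSpace.single i 1) - hK.bary.coord a 0 := by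
  rw [IsTetrahedron.gradLam, ← Bary.linear_sub, sub_zero]

theorem IsTetrahedron.sum_gradLam (i : Fin 3) : ∑ a ∈ K, hK.gradLam a i = 0 := by
  simp only [hK.gradLam_eq, Finset.sum_sub_distrib, Bary.sum_coord, sub_self]

theorem IsTetrahedron.sum_gradLam_smul (j : Fin 3) :
    ∑ a ∈ K, hK.gradLam a j • a = EuclideanSpace.single j (1 : ℝ) := by
  have h1 := hK.proj_bary (EuclideanSpace.single j 1)
  have h0 := hK.proj_bary 0
  rw [Bary.proj] at h1 h0
  simp only [hK.gradLam_eq, sub_smul, Finset.sum_sub_distrib, h1, h0, sub_zero]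

theorem IsTetrahedron.sum_lam : ∑ a ∈ K, hK.lam a = 1 := ev_ext fun x => by
  have h : ∀ a, eval x.ofLp (hK.lam a) = hK.bary.coord a x := fun a => ev_affPoly _ x
  simp only [ev, map_sum, h, Bary.sum_coord, map_one]

theorem IsTetrahedron.X_eq_sum (i : Fin 3) : X i = ∑ a ∈ K, hK.lam a * C (a i) :=
  ev_ext fun x => by
    have h : ∀ a, eval x.ofLp (hK.lam a) = hK.bary.coord a x := fun a => ev_affPoly _ x
    have h1 := congrArg (fun y : E3 => y i) (hK.proj_bary x)
    simp only [Bary.proj, sum_smul_apply] at h1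
    simp only [ev, map_sum, map_mul, h, eval_X, eval_C, h1]

theorem IsTetrahedron.one_lt_card (hK : IsTetrahedron K) : 1 < K.card := by
  rw [hK.card_eq]; norm_num

/-- Polynomials of degree at most `m` with `m ≥ 1` are combinations of the barycentric coordinates
with coefficients of degree at most `m - 1`. -/
theorem IsTetrahedron.exists_eq_sum_lam_mul {m : ℤ} (hm : 1 ≤ m) {g : Poly} (hg : g ∈ polyLE m) :
    ∃ h : E3 → Poly, (∀ a, h a ∈ polyLE (m - 1)) ∧ ∑ a ∈ K, hK.lam a * h a = g := by
  rw [polyLE, restrictSupport_eq_span] at hg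
  induction hg using Submodule.span_induction with
  | mem p hp =>
    obtain ⟨s, hs, rfl⟩ := hp
    change (s.degree : ℤ) ≤ m at hs
    by_cases h0 : s = 0
    · refine ⟨fun _ => 1, fun _ => C_mem_degLE (by linarith) 1, ?_⟩
      simp only [mul_one, hK.sum_lam, h0]
      rfl
    obtain ⟨i, hi⟩ := Finsupp.ne_iff.1 h0
    have h1 : Finsupp.single i 1 ≤ s := by
      rw [Finsupp.single_le_iff]
      exact Nat.one_le_iff_ne_zero.2 hi
    have h2 : (s - Finsupp.single i 1).degree + 1 = s.degree := by
      conv_rhs => rw [← tsub_add_cancel_of_le h1]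
      simp
    refine ⟨fun a => C (a i) * monomial (s - Finsupp.single i 1) 1, fun a => C_mul_mem_polyLE _
      ((monomial_mem_restrictSupport ℝ).2 (Or.inl ?_)), ?_⟩
    · change ((s - Finsupp.single i 1).degree : ℤ) ≤ m - 1
      omega
    · simp only [← mul_assoc, ← Finset.sum_mul, ← hK.X_eq_sum]
      rw [X, monomial_mul, add_tsub_cancel_of_le h1, one_mul]
  | zero => exact ⟨0, fun _ => Submodule.zero_mem _, by simp⟩
  | add p q _ _ hp hq =>
    obtain ⟨h, hm, rfl⟩ := hp
    obtain ⟨h', hm', rfl⟩ := hq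
    exact ⟨h + h', fun a => Submodule.add_mem _ (hm a) (hm' a), by
      simp [mul_add, Finset.sum_add_distrib]⟩
  | smul c p _ hp =>
    obtain ⟨h, hm, rfl⟩ := hp
    exact ⟨c • h, fun a => Submodule.smul_mem _ c (hm a), by simp [Finset.smul_sum]⟩

/-- The map `(h_a) ↦ ∑ λ_a h_a`. -/
def IsTetrahedron.lamSum (m : ℤ) : (K → polyLE (m - 1)) →ₗ[ℝ] polyLE m where
  toFun h := ⟨∑ a : K, hK.lam a * (h a : Poly), Submodule.sum_mem _ fun a _ => by
    have := mul_mem_degLE (affPoly_mem_polyLE (hK.bary.coord a)) (h a).2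
    rwa [add_sub_cancel] at this⟩
  map_add' h h' := by ext1; simp [mul_add, Finset.sum_add_distrib]
  map_smul' c h := by ext1; simp [Finset.smul_sum]

theorem IsTetrahedron.lamSum_surjective {m : ℤ} (hm : 1 ≤ m) :
    Function.Surjective (hK.lamSum m) := fun ⟨g, hg⟩ => by
  obtain ⟨h, hh, hs⟩ := hK.exists_eq_sum_lam_mul hm hg
  refine ⟨fun a => ⟨h a, hh a⟩, Subtype.ext (Eq.trans ?_ hs)⟩
  rw [← Finset.sum_coe_sort]
  rfl

/-- The map `(h_a) ↦ λ₁λ₂λ₃λ₄ ∑ λ_a h_a a` to vector fields. -/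
def IsTetrahedron.bubbleMap (m : ℤ) : (K → polyLE m) →ₗ[ℝ] VecPoly where
  toFun h i := (∏ a ∈ K, hK.lam a) * ∑ a : K, C ((a : E3) i) * (hK.lam a * (h a : Poly))
  map_add' h h' := by ext1 i; simp [mul_add, Finset.sum_add_distrib]
  map_smul' c h := by ext1 i; simp [← Finset.smul_sum]

theorem IsTetrahedron.ev_prod_lam (x : E3) :
    ev x (∏ a ∈ K, hK.lam a) = ∏ a : K, hK.basis.coord a x := by
  rw [ev, map_prod, ← Finset.prod_coe_sort]
  exact Finset.prod_congr rfl fun a _ => by rw [← hK.bary_coord]; exact ev_affPoly _ _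

/-- If `div (λ₁λ₂λ₃λ₄ p)` vanishes on the face opposite to `a`, then so does `∇λ_a · p`. -/
theorem IsTetrahedron.lam_dvd_gradLam {p : VecPoly} {a : E3} (ha : a ∈ K)
    (h : hK.lam a ∣ divP fun i => (∏ a ∈ K, hK.lam a) * p i) :
    hK.lam a ∣ ∑ i, C (hK.gradLam a i) * p i := by
  classical
  set b := ∏ c ∈ K.erase a, hK.lam c with hb
  have hprime : Prime (hK.lam a) := hK.bary.prime_coord hK.one_lt_card ha
  have h1 : (divP fun i => (∏ a ∈ K, hK.lam a) * p i) =
      b * (∑ i, C (hK.gradLam a i) * p i) + hK.lam a * ∑ i, pderiv i (b * p i) := by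
    rw [divP, Finset.mul_sum, Finset.mul_sum, ← Finset.sum_add_distrib]
    refine Finset.sum_congr rfl fun i _ => ?_
    rw [← Finset.mul_prod_erase _ _ ha, ← hb, mul_assoc, Derivation.leibniz, smul_eq_mul,
      smul_eq_mul, IsTetrahedron.lam, pderiv_affPoly]
    change _ = _ * (C ((hK.bary.coord a).linear _) * _) + _
    ring
  rw [h1, dvd_add_left (dvd_mul_right _ _)] at h
  refine (hprime.dvd_or_dvd h).resolve_left fun h2 => ?_
  obtain ⟨c, hc, h3⟩ := (hprime.dvd_finsetProd_iff _).1 h2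
  obtain ⟨hca, hcK⟩ := Finset.mem_erase.1 hc
  exact hK.bary.not_coord_dvd_coord ha hcK hca.symm h3

/-- A bubble `λ₁λ₂λ₃λ₄ p` is determined by the fluxes `∇λ_a · p`, which are of the form `λ_a h_a`
and have sum zero. -/
theorem divBubble_le_range (k : ℕ) : divBubble k hK ≤
    LinearMap.range (hK.bubbleMap ((k : ℤ) - 2 - 1) ∘ₗ
      (LinearMap.ker (hK.lamSum ((k : ℤ) - 2))).subtype) := by
  classical
  rintro q ⟨⟨p, hp, hq⟩, hdiv⟩
  have hq' : q = fun i => (∏ a ∈ K, hK.lam a) * p i := by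
    ext1 i
    refine ev_ext fun x => ?_
    rw [hq, ev_mul, hK.ev_prod_lam]
  have hdvd : ∀ a ∈ K, hK.lam a ∣ ∑ i, C (hK.gradLam a i) * p i := fun a ha => by
    refine hK.lam_dvd_gradLam ha ?_
    obtain ⟨b, hb, hba⟩ := Finset.exists_mem_ne hK.one_lt_card a
    rw [← hq', ← hK.pull_bary (divP q)]
    refine hK.bary.dvd_pull_of_vanishes ha hb hba.symm (vanishes_of_pos fun w hw0 hw => ?_)
    refine hdiv (K.erase a) (Finset.mem_powersetCard.2 ⟨Finset.erase_subset _ _, ?_⟩) _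
      (mem_hull_iff.2 ⟨w, fun c hc => (hw0 c hc).le, hw, rfl⟩)
    rw [Finset.card_erase_of_mem ha, hK.card_eq]
  choose! h hh using hdvd
  have hm : ∀ a ∈ K, h a ∈ polyLE ((k : ℤ) - 2 - 1) := fun a ha => by
    have h1 : ∑ i, C (hK.gradLam a i) * p i ∈ polyLE ((k : ℤ) - 2) :=
      Submodule.sum_mem _ fun i _ => C_mul_mem_polyLE _ (mem_vecPolyLE.1 hp i)
    rw [hh a ha] at h1
    have h2 := mem_degLE_of_mul (hK.bary.prime_coord hK.one_lt_card ha).ne_zero h1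
    rwa [hK.bary.totalDegree_coord hK.one_lt_card ha] at h2
  have hcomb : ∀ c : E3 → ℝ, ∑ a : K, C (c a) * (hK.lam a * h a) =
      ∑ i, C (∑ a ∈ K, c a * hK.gradLam a i) * p i := fun c => by
    rw [Finset.sum_coe_sort K fun a => C (c a) * (hK.lam a * h a)]
    simp only [map_sum, Finset.sum_mul]
    rw [Finset.sum_comm]
    refine Finset.sum_congr rfl fun a ha => ?_
    rw [← hh a ha, Finset.mul_sum]
    exact Finset.sum_congr rfl fun i _ => by rw [C_mul, mul_assoc]
  refine ⟨⟨fun a => ⟨h a, hm a a.2⟩, ?_⟩, ?_⟩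
  · rw [LinearMap.mem_ker]
    refine Subtype.ext ?_
    have := hcomb fun _ => 1
    simp only [one_mul, hK.sum_gradLam, map_zero, map_one, zero_mul, Finset.sum_const_zero] at this
    exact this
  · rw [hq']
    ext1 i
    change (∏ a ∈ K, hK.lam a) * ∑ a : K, C ((a : E3) i) * (hK.lam a * h a) = _
    rw [hcomb fun a => a i]
    congr 1
    have h1 : ∀ j, ∑ a ∈ K, a i * hK.gradLam a j = if i = j then 1 else 0 := fun j => by
      have := congrArg (fun y : E3 => y i) (hK.sum_gradLam_smul j)
      simp only [sum_smul_apply] at this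
      simp only [mul_comm, this]
      simp
    simp [h1]

instance finite_polyLE (m : ℤ) : Module.Finite ℝ (polyLE m) := finite_degLE 3 m

theorem finite_divBubble (k : ℕ) : Module.Finite ℝ (divBubble k hK) :=
  Submodule.finiteDimensional_of_le (divBubble_le_range hK k)

theorem finrank_divBubble_add_le {k : ℕ} (hk : 3 ≤ k) :
    Module.finrank ℝ (divBubble k hK) + Module.finrank ℝ (polyLE ((k : ℤ) - 2)) ≤
      4 * Module.finrank ℝ (polyLE ((k : ℤ) - 3)) := by
  have h1 := (Submodule.finrank_mono (divBubble_le_range hK k)).trans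
    (LinearMap.finrank_range_le _)
  have h2 := (hK.lamSum ((k : ℤ) - 2)).finrank_range_add_finrank_ker
  rw [LinearMap.range_eq_top.2 (hK.lamSum_surjective (by omega)), finrank_top,
    Module.finrank_pi_fintype] at h2
  simp only [Finset.sum_const, Finset.card_univ, Fintype.card_coe, hK.card_eq, smul_eq_mul] at h2
  have h3 : Module.finrank ℝ (polyLE ((k : ℤ) - 2 - 1)) =
      Module.finrank ℝ (polyLE ((k : ℤ) - 3)) := by
    rw [show (k : ℤ) - 2 - 1 = k - 3 by ring]
  omega

end Bubble


/-! ### The space of degrees of freedom -/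

/-- The moments of `g` as a linear functional on the polynomials on `s`, depending linearly on `g`. A
polynomial function on `s` is integrated through a linear choice of an extension to `ℝ³`. -/
theorem exists_momentMap {s : Finset E3} {d : ℕ} (hs : AffineIndependent ℝ ((↑) : s → E3))
    (hd : s.card = d + 1) (m : ℤ) : ∃ M : Poly →ₗ[ℝ] Module.Dual ℝ (PolyOn m s),
      ∀ g ℓ, HasMoments d m s g ℓ ↔ M g = ℓ := by
  obtain ⟨σ, hσ⟩ := (onto m s).exists_rightInverse_of_surjective
    (LinearMap.range_rangeRestrict (restr m s))
  have hi : ∀ g q : Poly, Integrable (fun x => ev x g * ev x q)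
    ((μHE[d] : Measure E3).restrict (hull s)) := integrable_ev_mul hs hd
  let M : Poly →ₗ[ℝ] Module.Dual ℝ (PolyOn m s) := LinearMap.mk₂ ℝ
    (fun g y => ∫ x in hull s, ev x g * ev x (σ y : Poly) ∂(μHE[d] : Measure E3))
    (fun g g' y => by
      simp only [ev_add, add_mul]
      exact integral_add (hi _ _) (hi _ _))
    (fun c g y => by
      simp only [ev_smul, mul_assoc, smul_eq_mul]
      exact integral_const_mul _ _)
    (fun g y y' => by
      simp only [map_add, Submodule.coe_add, ev_add, mul_add]
      exact integral_add (hi _ _) (hi _ _))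
    (fun c g y => by
      simp only [map_smul, Submodule.coe_smul, ev_smul, mul_left_comm _ c, smul_eq_mul]
      exact integral_const_mul _ _)
  have hM : ∀ g (q : polyLE m), ∫ x in hull s, ev x g * ev x q ∂(μHE[d] : Measure E3) =
      M g (onto m s q) := fun g q => by
    refine setIntegral_congr_fun (isCompact_hull s).measurableSet fun x hx => ?_
    have h1 : onto m s (σ (onto m s q)) = onto m s q := LinearMap.congr_fun hσ _
    have h2 : ev x (σ (onto m s q) : Poly) = ev x q :=
      congrFun (congrArg Subtype.val h1) ⟨x, hx⟩
    rw [h2]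
  refine ⟨M, fun g ℓ => ⟨fun h => LinearMap.ext fun y => ?_, fun h q => ?_⟩⟩
  · have h1 : onto m s (σ y) = y := LinearMap.congr_fun hσ y
    rw [← h1, ← hM, h]
  · rw [hM, h]

/-- Index pairs for the entries of a symmetric `3 × 3` matrix. -/
abbrev SymIndex : Type := {p : Fin 3 × Fin 3 // p.1 ≤ p.2}

/-- The space of vertex data. -/
abbrev VertexSpace : Type :=
  (Fin 3 → ℝ) × (Fin 3 → Fin 3 → ℝ) × (Fin 3 → SymIndex → ℝ) × (SymIndex → ℝ)

/-- The space of edge data. -/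
abbrev EdgeSpace (k : ℕ) (e : Finset E3) : Type :=
  (Fin 3 → Module.Dual ℝ (PolyOn ((k : ℤ) - 4) e)) × Module.Dual ℝ (PolyOn ((k : ℤ) - 5) e) ×
    (Fin 5 → Module.Dual ℝ (PolyOn ((k : ℤ) - 3) e)) ×
    (Fin 2 → Module.Dual ℝ (PolyOn ((k : ℤ) - 4) e))

/-- The space of face data. -/
abbrev FaceSpace (k : ℕ) (f : Finset E3) : Type :=
  (Fin 3 → Module.Dual ℝ (PolyOn ((k : ℤ) - 4) f)) × Module.Dual ℝ (PolyOn ((k : ℤ) - 5) f)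

/-- Vertex data as an element of a vector space. -/
def VertexData.enc (D : VertexData) : VertexSpace :=
  (D.val, fun i j => D.grad i j, fun i p => D.hess i p.1.1 p.1.2, fun p => D.hessDiv p.1.1 p.1.2)

/-- Edge data as an element of a vector space. -/
def EdgeData.enc {k : ℕ} {e : Finset E3} (D : EdgeData k e) : EdgeSpace k e :=
  (fun i => D.val ∘ₗ LinearMap.single ℝ (fun _ => PolyOn ((k : ℤ) - 4) e) i, D.div,
    ![D.np_np, D.np_nm, D.t_np, D.t_nm, D.nm_np], ![D.div_np, D.div_nm])

/-- Face data as an element of a vector space. -/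
def FaceData.enc {k : ℕ} {f : Finset E3} (D : FaceData k f) : FaceSpace k f :=
  (fun i => D.val ∘ₗ LinearMap.single ℝ (fun _ => PolyOn ((k : ℤ) - 4) f) i, D.div)

theorem pderiv_comm (i j : Fin 3) (p : Poly) :
    pderiv i (pderiv j p) = pderiv j (pderiv i p) := by
  have h : ⁅pderiv (R := ℝ) i, pderiv j⁆ = 0 := derivation_ext fun l => by
    rw [Derivation.commutator_apply, pderiv_X, pderiv_X, Pi.single_apply, Pi.single_apply]
    split_ifs <;> simp
  have := DFunLike.congr_fun h p
  rwa [Derivation.commutator_apply, Derivation.zero_apply, sub_eq_zero] at this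

theorem exists_vertexMap (a : E3) : ∃ M : VecPoly →ₗ[ℝ] VertexSpace,
    ∀ v D, HasVertexDofs a v D ↔ M v = D.enc := by
  let pd (j : Fin 3) : Poly →ₗ[ℝ] Poly := (pderiv j).toLinearMap
  let comp (i : Fin 3) : VecPoly →ₗ[ℝ] Poly := LinearMap.proj i
  let M : VecPoly →ₗ[ℝ] VertexSpace :=
    (LinearMap.pi fun i => evL a ∘ₗ comp i).prod <|
    (LinearMap.pi fun i => LinearMap.pi fun j => evL a ∘ₗ pd j ∘ₗ comp i).prod <|
    (LinearMap.pi fun i => LinearMap.pi fun p : SymIndex =>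
      evL a ∘ₗ pd p.1.1 ∘ₗ pd p.1.2 ∘ₗ comp i).prod
    (LinearMap.pi fun p : SymIndex => evL a ∘ₗ pd p.1.1 ∘ₗ pd p.1.2 ∘ₗ divL)
  have hsymm : ∀ (p : Poly) (A : Matrix (Fin 3) (Fin 3) ℝ), A.IsSymm →
      (∀ s : SymIndex, ev a (pderiv s.1.1 (pderiv s.1.2 p)) = A s.1.1 s.1.2) →
      ∀ j l, ev a (pderiv j (pderiv l p)) = A j l := fun p A hA h j l => by
    rcases le_total j l with hjl | hjl
    · exact h ⟨(j, l), hjl⟩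
    · rw [pderiv_comm, ← hA.apply]
      exact h ⟨(l, j), hjl⟩
  refine ⟨M, fun v D => ⟨fun h => ?_, fun h => ?_⟩⟩
  · refine Prod.ext (funext h.val) (Prod.ext (funext fun i => funext (h.grad i)) (Prod.ext ?_ ?_))
    · exact funext fun i => funext fun p => h.hess i p.1.1 p.1.2
    · exact funext fun p => h.hessDiv p.1.1 p.1.2
  · obtain ⟨h1, h⟩ := Prod.ext_iff.1 h
    obtain ⟨h2, h⟩ := Prod.ext_iff.1 h
    obtain ⟨h3, h4⟩ := Prod.ext_iff.1 h
    exact ⟨fun i => congrFun h1 i, fun i j => congrFun (congrFun h2 i) j,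
      fun i => hsymm _ _ (D.hess_symm i) fun s => congrFun (congrFun h3 i) s,
      hsymm _ _ D.hessDiv_symm fun s => congrFun h4 s⟩

theorem exists_edgeMap (k : ℕ) {e : Finset E3} (he : AffineIndependent ℝ ((↑) : e → E3))
    (hc : e.card = 2) (F : EdgeFrame) : ∃ M : VecPoly →ₗ[ℝ] EdgeSpace k e,
      ∀ v D, HasEdgeDofs k e F v D ↔ M v = D.enc := by
  obtain ⟨M3, h3⟩ := exists_momentMap he hc ((k : ℤ) - 3)
  obtain ⟨M4, h4⟩ := exists_momentMap he hc ((k : ℤ) - 4)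
  obtain ⟨M5, h5⟩ := exists_momentMap he hc ((k : ℤ) - 5)
  let M : VecPoly →ₗ[ℝ] EdgeSpace k e :=
    (LinearMap.pi fun i => M4 ∘ₗ LinearMap.proj i).prod <| (M5 ∘ₗ divL).prod <|
    (LinearMap.pi ![M3 ∘ₗ dirL F.np ∘ₗ dotL F.np, M3 ∘ₗ dirL F.nm ∘ₗ dotL F.np,
      M3 ∘ₗ dirL F.np ∘ₗ dotL F.t, M3 ∘ₗ dirL F.nm ∘ₗ dotL F.t,
      M3 ∘ₗ dirL F.np ∘ₗ dotL F.nm]).prod <|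
    LinearMap.pi ![M4 ∘ₗ dirL F.np ∘ₗ divL, M4 ∘ₗ dirL F.nm ∘ₗ divL]
  refine ⟨M, fun v D => ⟨fun h => ?_, fun h => ?_⟩⟩
  · refine Prod.ext (funext fun i => ?_) (Prod.ext ?_ (Prod.ext (funext fun i => ?_)
      (funext fun i => ?_)))
    · exact (h4 _ _).1 ((hasVecMoments_iff he hc).1 h.val i)
    · exact (h5 _ _).1 h.div
    · fin_cases i
      exacts [(h3 _ _).1 h.np_np, (h3 _ _).1 h.np_nm, (h3 _ _).1 h.t_np, (h3 _ _).1 h.t_nm,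
        (h3 _ _).1 h.nm_np]
    · fin_cases i
      exacts [(h4 _ _).1 h.div_np, (h4 _ _).1 h.div_nm]
  · obtain ⟨g1, h⟩ := Prod.ext_iff.1 h
    obtain ⟨g2, h⟩ := Prod.ext_iff.1 h
    obtain ⟨g3, g4⟩ := Prod.ext_iff.1 h
    exact ⟨(hasVecMoments_iff he hc).2 fun i => (h4 _ _).2 (congrFun g1 i), (h5 _ _).2 g2,
      (h3 _ _).2 (congrFun g3 0), (h3 _ _).2 (congrFun g3 1), (h3 _ _).2 (congrFun g3 2),
      (h3 _ _).2 (congrFun g3 3), (h3 _ _).2 (congrFun g3 4), (h4 _ _).2 (congrFun g4 0),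
      (h4 _ _).2 (congrFun g4 1)⟩

theorem exists_faceMap (k : ℕ) {f : Finset E3} (hf : AffineIndependent ℝ ((↑) : f → E3))
    (hc : f.card = 3) : ∃ M : VecPoly →ₗ[ℝ] FaceSpace k f,
      ∀ v D, HasFaceDofs k f v D ↔ M v = D.enc := by
  obtain ⟨M4, h4⟩ := exists_momentMap hf hc ((k : ℤ) - 4)
  obtain ⟨M5, h5⟩ := exists_momentMap hf hc ((k : ℤ) - 5)
  let M : VecPoly →ₗ[ℝ] FaceSpace k f :=
    (LinearMap.pi fun i => M4 ∘ₗ LinearMap.proj i).prod (M5 ∘ₗ divL)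
  refine ⟨M, fun v D => ⟨fun h => ?_, fun h => ?_⟩⟩
  · exact Prod.ext (funext fun i => (h4 _ _).1 ((hasVecMoments_iff hf hc).1 h.val i))
      ((h5 _ _).1 h.div)
  · obtain ⟨g1, g2⟩ := Prod.ext_iff.1 h
    exact ⟨(hasVecMoments_iff hf hc).2 fun i => (h4 _ _).2 (congrFun g1 i), (h5 _ _).2 g2⟩

section Unisolvence

variable {K : Finset E3} (hK : IsTetrahedron K)

theorem exists_interiorMap (k : ℕ) : ∃ M : VecPoly →ₗ[ℝ] Module.Dual ℝ (divBubble k hK),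
    ∀ v ℓ, (∀ q : divBubble k hK, ∫ x in hull K, ∑ i, ev x (v i) * ev x (q.1 i) = ℓ q) ↔
      M v = ℓ := by
  have hi := integrable_sum_ev_mul K
  refine ⟨LinearMap.mk₂ ℝ
    (fun v (q : divBubble k hK) => ∫ x in hull K, ∑ i, ev x (v i) * ev x (q.1 i))
    (fun v v' q => ?_) (fun c v q => ?_) (fun v q q' => ?_) (fun c v q => ?_),
    fun v ℓ => ⟨fun h => LinearMap.ext h, fun h q => LinearMap.congr_fun h q⟩⟩
  · simp only [Pi.add_apply, ev_add, add_mul, Finset.sum_add_distrib]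
    exact integral_add (hi _ _) (hi _ _)
  · simp only [Pi.smul_apply, ev_smul, mul_assoc, smul_eq_mul, ← Finset.mul_sum]
    exact integral_const_mul _ _
  · simp only [Submodule.coe_add, Pi.add_apply, ev_add, mul_add, Finset.sum_add_distrib]
    exact integral_add (hi _ _) (hi _ _)
  · simp only [Submodule.coe_smul, Pi.smul_apply, ev_smul, mul_left_comm _ c, smul_eq_mul,
      ← Finset.mul_sum]
    exact integral_const_mul _ _

/-- The space of all data on a tetrahedron. -/
abbrev DofSpace (k : ℕ) : Type :=
  (K → VertexSpace) × (∀ e : K.powersetCard 2, EdgeSpace k e) ×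
    (∀ f : K.powersetCard 3, FaceSpace k f) × Module.Dual ℝ (divBubble k hK)

/-- Data on a tetrahedron as an element of a vector space. -/
def DofData.enc {k : ℕ} {hK : IsTetrahedron K} (D : DofData k hK) : DofSpace hK k :=
  (fun a => (D.vertex a).enc, fun e => (D.edge e).enc, fun f => (D.face f).enc, D.interior)

theorem exists_dofMap (k : ℕ) (frame : Finset E3 → EdgeFrame) :
    ∃ M : VecPoly →ₗ[ℝ] DofSpace hK k, ∀ v D, HasDofs k hK frame v D ↔ M v = D.enc := by
  choose MV hV using exists_vertexMap
  choose ME hE using fun e : K.powersetCard 2 => exists_edgeMap k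
    (hK.affineIndependent (Finset.mem_powersetCard.1 e.2).1) (Finset.mem_powersetCard.1 e.2).2
    (frame e)
  choose MF hF using fun f : K.powersetCard 3 => exists_faceMap k
    (hK.affineIndependent (Finset.mem_powersetCard.1 f.2).1) (Finset.mem_powersetCard.1 f.2).2
  obtain ⟨MI, hI⟩ := exists_interiorMap hK k
  let M : VecPoly →ₗ[ℝ] DofSpace hK k :=
    (LinearMap.pi fun a : K => MV a).prod <| (LinearMap.pi ME).prod <| (LinearMap.pi MF).prod MI
  refine ⟨M, fun v D => ⟨fun h => ?_, fun h => ?_⟩⟩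
  · exact Prod.ext (funext fun a => (hV _ _ _).1 (h.vertex a)) <|
      Prod.ext (funext fun e => (hE _ _ _).1 (h.edge e)) <|
      Prod.ext (funext fun f => (hF _ _ _).1 (h.face f)) ((hI _ _).1 h.interior)
  · obtain ⟨g1, h⟩ := Prod.ext_iff.1 h
    obtain ⟨g2, h⟩ := Prod.ext_iff.1 h
    obtain ⟨g3, g4⟩ := Prod.ext_iff.1 h
    exact ⟨fun a => (hV _ _ _).2 (congrFun g1 a), fun e => (hE _ _ _).2 (congrFun g2 e),
      fun f => (hF _ _ _).2 (congrFun g3 f), (hI _ _).2 g4⟩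

/-- The zero vector encodes data, with which injectivity of the map to the space of data is reduced
to uniqueness. -/
theorem exists_enc_eq_zero (k : ℕ) : ∃ D : DofData k hK, D.enc = 0 := by
  refine ⟨⟨fun _ => ⟨0, 0, 0, fun _ => Matrix.isSymm_zero, 0, Matrix.isSymm_zero⟩,
    fun _ => ⟨0, 0, 0, 0, 0, 0, 0, 0, 0⟩, fun _ => ⟨0, 0⟩, 0⟩, ?_⟩
  refine Prod.ext rfl (Prod.ext (funext fun e => ?_) rfl)
  refine Prod.ext rfl (Prod.ext rfl (Prod.ext (funext fun i => ?_) (funext fun i => ?_))) <;>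
    fin_cases i <;> rfl

end Unisolvence


/-! ### Unisolvence -/

theorem finrank_vertexSpace : Module.finrank ℝ VertexSpace = 36 := by
  have : Fintype.card SymIndex = 6 := by decide
  simp only [VertexSpace, Module.finrank_prod, Module.finrank_pi, Module.finrank_pi_fintype,
    Finset.sum_const, Finset.card_univ, Fintype.card_fin, this, smul_eq_mul]

/-- The bound is `3(k-3) + (k-4) + 5(k-2) + 2(k-3)` for `k = j + 4`. -/
theorem finrank_edgeSpace_le {K e : Finset E3} (hK : IsTetrahedron K) (he : e ∈ K.powersetCard 2)
    (j : ℕ) : Module.finrank ℝ (EdgeSpace (j + 4) e) ≤ 11 * j + 15 := by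
  obtain ⟨he, hc⟩ := Finset.mem_powersetCard.1 he
  have h : ∀ n : ℕ, ∀ m : ℤ, m = n - 1 → Module.finrank ℝ (PolyOn m e) ≤ n := fun n m hm => by
    have := finrank_polyOn_le hK he (d := 1) hc m
    rwa [hm, finrank_degLE 0 n, Nat.choose_one_right, ← hm] at this
  have h3 := h (j + 2) (((j + 4 : ℕ) : ℤ) - 3) (by push_cast; ring)
  have h4 := h (j + 1) (((j + 4 : ℕ) : ℤ) - 4) (by push_cast; ring)
  have h5 := h j (((j + 4 : ℕ) : ℤ) - 5) (by push_cast; ring)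
  simp only [EdgeSpace, Module.finrank_prod, Module.finrank_pi_fintype, Finset.sum_const,
    Finset.card_univ, Fintype.card_fin, smul_eq_mul, Subspace.dual_finrank_eq]
  omega

theorem finrank_faceSpace_le {K f : Finset E3} (hK : IsTetrahedron K) (hf : f ∈ K.powersetCard 3)
    (j : ℕ) : Module.finrank ℝ (FaceSpace (j + 4) f) ≤
      3 * (j + 2).choose 2 + (j + 1).choose 2 := by
  obtain ⟨hf, hc⟩ := Finset.mem_powersetCard.1 hf
  have h : ∀ n : ℕ, ∀ m : ℤ, m = n - 1 → Module.finrank ℝ (PolyOn m f) ≤ (n + 1).choose 2 :=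
    fun n m hm => by
      have := finrank_polyOn_le hK hf (d := 2) hc m
      rwa [hm, finrank_degLE 1 n, ← hm] at this
  have h4 : _ ≤ (j + 2).choose 2 := h (j + 1) (((j + 4 : ℕ) : ℤ) - 4) (by push_cast; ring)
  have h5 := h j (((j + 4 : ℕ) : ℤ) - 5) (by push_cast; ring)
  simp only [FaceSpace, Module.finrank_prod, Module.finrank_pi_fintype, Finset.sum_const,
    Finset.card_univ, Fintype.card_fin, smul_eq_mul, Subspace.dual_finrank_eq]
  omega

theorem finrank_polyLE (n : ℕ) {m : ℤ} (hm : m = n - 1) :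
    Module.finrank ℝ (polyLE m) = (n + 2).choose 3 := by
  rw [hm]
  exact finrank_degLE 2 n

theorem two_mul_choose_two (n : ℕ) : 2 * (n + 1).choose 2 = (n + 1) * n := by
  induction n with
  | zero => simp
  | succ n ih =>
    rw [Nat.choose_succ_succ (n + 1) 1, Nat.choose_one_right, mul_add, ih]
    ring

theorem six_mul_choose_three (n : ℕ) : 6 * (n + 2).choose 3 = (n + 2) * (n + 1) * n := by
  induction n with
  | zero => simp
  | succ n ih =>
    have h := two_mul_choose_two (n + 1)
    rw [Nat.choose_succ_succ (n + 2) 2, mul_add, ih]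
    nlinarith

instance finite_edgeSpace (k : ℕ) (e : Finset E3) : Module.Finite ℝ (EdgeSpace k e) :=
  Module.Finite.prod

instance finite_faceSpace (k : ℕ) (f : Finset E3) : Module.Finite ℝ (FaceSpace k f) :=
  Module.Finite.prod

theorem finite_dofSpace {K : Finset E3} (hK : IsTetrahedron K) (k : ℕ) :
    Module.Finite ℝ (DofSpace hK k) := by
  have := finite_divBubble hK k
  have hE : Module.Finite ℝ (∀ e : K.powersetCard 2, EdgeSpace k e) := Module.Finite.pi
  have hF : Module.Finite ℝ (∀ f : K.powersetCard 3, FaceSpace k f) := Module.Finite.pi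
  have hV : Module.Finite ℝ (K → VertexSpace) := Module.Finite.pi
  have hFI : Module.Finite ℝ ((∀ f : K.powersetCard 3, FaceSpace k f) ×
    Module.Dual ℝ (divBubble k hK)) := Module.Finite.prod
  have hEFI : Module.Finite ℝ ((∀ e : K.powersetCard 2, EdgeSpace k e) ×
    (∀ f : K.powersetCard 3, FaceSpace k f) × Module.Dual ℝ (divBubble k hK)) :=
    Module.Finite.prod
  exact Module.Finite.prod

theorem finrank_prod_four (A B C D : Type*) [AddCommGroup A] [Module ℝ A] [AddCommGroup B]
    [Module ℝ B] [AddCommGroup C] [Module ℝ C] [AddCommGroup D] [Module ℝ D] [Module.Finite ℝ A]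
    [Module.Finite ℝ B] [Module.Finite ℝ C] [Module.Finite ℝ D] :
    Module.finrank ℝ (A × B × C × D) = Module.finrank ℝ A +
      (Module.finrank ℝ B + (Module.finrank ℝ C + Module.finrank ℝ D)) := by
  rw [Module.finrank_prod, Module.finrank_prod, Module.finrank_prod]

/-- The space of data has at most the dimension of the space of fields, which is
`3 * (j + 9).choose 3` for `k = j + 4`. -/
theorem finrank_dofSpace_le {K : Finset E3} (hK : IsTetrahedron K) (j : ℕ) :
    Module.finrank ℝ (DofSpace hK (j + 4)) ≤ 3 * (j + 9).choose 3 := by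
  have := finite_divBubble hK (j + 4)
  have hE : ∑ e : K.powersetCard 2, Module.finrank ℝ (EdgeSpace (j + 4) e) ≤
      6 * (11 * j + 15) := by
    refine (Finset.sum_le_card_nsmul _ _ _ fun e _ => finrank_edgeSpace_le hK e.2 j).trans ?_
    rw [Finset.card_univ, Fintype.card_coe, Finset.card_powersetCard, hK.card_eq]
    rfl
  have hF : ∑ f : K.powersetCard 3, Module.finrank ℝ (FaceSpace (j + 4) f) ≤
      4 * (3 * (j + 2).choose 2 + (j + 1).choose 2) := by
    refine (Finset.sum_le_card_nsmul _ _ _ fun f _ => finrank_faceSpace_le hK f.2 j).trans ?_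
    rw [Finset.card_univ, Fintype.card_coe, Finset.card_powersetCard, hK.card_eq]
    rfl
  have hI := finrank_divBubble_add_le hK (k := j + 4) (by omega)
  rw [finrank_polyLE (j + 3) (by push_cast; ring), finrank_polyLE (j + 2) (by push_cast; ring)]
    at hI
  have h1 : Module.finrank ℝ (DofSpace hK (j + 4)) =
      4 * 36 + (∑ e : K.powersetCard 2, Module.finrank ℝ (EdgeSpace (j + 4) e) +
        (∑ f : K.powersetCard 3, Module.finrank ℝ (FaceSpace (j + 4) f) +
          Module.finrank ℝ (divBubble (j + 4) hK))) := by
    have hE : Module.Finite ℝ (∀ e : K.powersetCard 2, EdgeSpace (j + 4) e) := Module.Finite.pi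
    have hF : Module.Finite ℝ (∀ f : K.powersetCard 3, FaceSpace (j + 4) f) := Module.Finite.pi
    have hV : Module.Finite ℝ (K → VertexSpace) := Module.Finite.pi
    rw [finrank_prod_four, Module.finrank_pi_fintype,
      Module.finrank_pi_fintype, Module.finrank_pi_fintype, Subspace.dual_finrank_eq]
    simp only [finrank_vertexSpace, Finset.sum_const, Finset.card_univ, Fintype.card_coe,
      hK.card_eq, smul_eq_mul]
  -- both sides are cubic polynomials in `j`, and they are equal
  have c1 := two_mul_choose_two (j + 1)
  have c2 := two_mul_choose_two j
  have c3 := six_mul_choose_three (j + 3)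
  have c4 := six_mul_choose_three (j + 2)
  have c5 := six_mul_choose_three (j + 7)
  simp only [add_assoc, Nat.reduceAdd] at c1 c2 c3 c4 c5 hI
  rw [h1]
  nlinarith

/-- The components of a field of degree at most `m` as independent variables. -/
def fieldMap (m : ℤ) : (Fin 3 → polyLE m) →ₗ[ℝ] VecPoly :=
  LinearMap.pi fun i => (polyLE m).subtype ∘ₗ LinearMap.proj i

theorem fieldMap_mem (m : ℤ) (u : Fin 3 → polyLE m) : fieldMap m u ∈ vecPolyLE m :=
  mem_vecPolyLE.2 fun i => (u i).2

/-- The fields of degree at most `k + 2` are determined by their degrees of freedom, which can be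
prescribed arbitrarily since they are not more numerous than the dimension. -/
theorem existsUnique_hasDofs {k : ℕ} (hk : 4 ≤ k) {K : Finset E3} (hK : IsTetrahedron K)
    {frame : Finset E3 → EdgeFrame} (hframe : ∀ e ∈ K.powersetCard 2, (frame e).IsAdapted e)
    (D : DofData k hK) : ∃! v : VecPoly, v ∈ vecPolyLE ((k : ℤ) + 2) ∧ HasDofs k hK frame v D := by
  obtain ⟨j, rfl⟩ := Nat.exists_eq_add_of_le' hk
  obtain ⟨M, hM⟩ := exists_dofMap hK (j + 4) frame
  obtain ⟨D0, hD0⟩ := exists_enc_eq_zero hK (j + 4)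
  have := finite_divBubble hK (j + 4)
  have := finite_dofSpace hK (j + 4)
  let L := M ∘ₗ fieldMap (((j + 4 : ℕ) : ℤ) + 2)
  have hinj : Function.Injective L := by
    rw [← LinearMap.ker_eq_bot, LinearMap.ker_eq_bot']
    intro u hu
    have h1 : fieldMap _ u = 0 := HasDofs.unique hframe (fieldMap_mem _ u)
      (Submodule.zero_mem _) ((hM _ D0).2 (by rw [hD0]; exact hu))
      ((hM _ D0).2 (by rw [hD0, map_zero]))
    funext i
    exact Subtype.ext (congrFun h1 i)
  have hrank : Module.finrank ℝ (Fin 3 → polyLE (((j + 4 : ℕ) : ℤ) + 2)) =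
      3 * (j + 9).choose 3 := by
    rw [Module.finrank_pi_fintype]
    simp only [finrank_polyLE (j + 7) (m := ((j + 4 : ℕ) : ℤ) + 2) (by push_cast; ring),
      Finset.sum_const, Finset.card_univ, Fintype.card_fin, smul_eq_mul]
  have hsurj : Function.Surjective L :=
    (LinearMap.injective_iff_surjective_of_finrank_eq_finrank (le_antisymm
      (LinearMap.finrank_le_finrank_of_injective hinj)
      (hrank ▸ finrank_dofSpace_le hK j))).1 hinj
  obtain ⟨u, hu⟩ := hsurj D.enc
  exact ⟨fieldMap _ u, ⟨fieldMap_mem _ u, (hM _ D).2 hu⟩, fun w hw =>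
    HasDofs.unique hframe hw.1 (fieldMap_mem _ u) hw.2 ((hM _ D).2 hu)⟩


/-! ### Conformity -/

section Conformity

variable {k : ℕ} {T : Geometry.SimplicialComplex ℝ E3} {frame : Finset E3 → EdgeFrame}
  {p : Finset E3 → VecPoly}

theorem isTetrahedron_of_mem_cells {K : Finset E3} (hK : K ∈ cells T) : IsTetrahedron K :=
  ⟨hK.2, T.indep hK.1⟩

open Classical in
theorem mem_hull_inter {K K' : Finset E3} (hK : K ∈ cells T) (hK' : K' ∈ cells T) {x : E3}
    (hx : x ∈ hull K) (hx' : x ∈ hull K') : x ∈ hull (K ∩ K') := by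
  have := T.inter_subset_convexHull hK.1 hK'.1 ⟨hx, hx'⟩
  rwa [← Finset.coe_inter] at this

/-- Single-valued degrees of freedom make the fields and their divergences continuous across common
vertices, edges and faces. -/
theorem ev_eq_of_isSingleValued
    (hframe : ∀ e ∈ T.faces, e.card = 2 → (frame e).IsAdapted e)
    (hp : IsSingleValued k T frame p) {K K' : Finset E3} (hK : K ∈ cells T) (hK' : K' ∈ cells T)
    {x : E3} (hx : x ∈ hull K) (hx' : x ∈ hull K') :
    (∀ i, ev x (p K i) = ev x (p K' i)) ∧ ev x (divP (p K)) = ev x (divP (p K')) := by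
  classical
  have hxs := mem_hull_inter hK hK' hx hx'
  have htet := isTetrahedron_of_mem_cells hK
  set s := K ∩ K' with hs
  have hsK : s ⊆ K := Finset.inter_subset_left
  have hsK' : s ⊆ K' := Finset.inter_subset_right
  have hcard : s.card ≤ 4 := hK.2 ▸ Finset.card_le_card hsK
  suffices h : (∀ i, ev x ((p K - p K') i) = 0) ∧ ev x (divP (p K - p K')) = 0 by
    simpa only [Pi.sub_apply, divP_sub, ev_sub, sub_eq_zero] using h
  set w := p K - p K' with hw
  have hwm : w ∈ vecPolyLE ((k : ℤ) + 2) :=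
    Submodule.sub_mem _ (hp.degree K hK) (hp.degree K' hK')
  have hvert : ∀ a ∈ s, ZeroVertexDofs a w := fun a ha => by
    obtain ⟨D, hD⟩ := hp.vertex a
    exact (hD K hK (hsK ha)).sub (hD K' hK' (hsK' ha))
  have hedge : ∀ e ⊆ s, e.card = 2 → Flat e w := fun e he hc => by
    obtain ⟨D, hD⟩ := hp.edge e hc
    have hne : e.Nonempty := Finset.card_pos.1 (by omega)
    exact flat_edge htet (he.trans hsK) hc
      (hframe e (T.down_closed hK.1 (he.trans hsK) hne) hc) hwm (fun a ha => hvert a (he ha))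
      ((hD K hK (he.trans hsK)).sub (htet.affineIndependent (he.trans hsK)) hc
        (hD K' hK' (he.trans hsK')))
  obtain h | h | h | h | h : s.card = 0 ∨ s.card = 1 ∨ s.card = 2 ∨ s.card = 3 ∨ s.card = 4 := by
    omega
  · rw [Finset.card_eq_zero.1 h] at hxs
    simp [hull] at hxs
  · obtain ⟨a, ha⟩ := Finset.card_eq_one.1 h
    rw [ha] at hxs
    obtain rfl : x = a := by simpa [hull] using hxs
    have hv := hvert x (ha ▸ Finset.mem_singleton_self x)
    exact ⟨hv.val, by simp [ev_divP, hv.grad]⟩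
  · have hf := hedge s subset_rfl h
    exact ⟨fun i => (hf.val i).ev_eq_zero hxs, hf.div.ev_eq_zero hxs⟩
  · obtain ⟨D, hD⟩ := hp.face s h
    have hf := vanishes_on_face htet hsK h hwm hedge
      ((hD K hK hsK).sub (htet.affineIndependent hsK) h (hD K' hK' hsK'))
    exact ⟨fun i => (hf.1 i).ev_eq_zero hxs, hf.2.ev_eq_zero hxs⟩
  · have h1 : s = K := Finset.eq_of_subset_of_card_le hsK (by rw [h, hK.2])
    have h2 : s = K' := Finset.eq_of_subset_of_card_le hsK' (by rw [h, hK'.2])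
    rw [hw, ← h1, ← h2, sub_self]
    simp [ev, divP]

/-- The interior of a tetrahedron of the grid does not meet the other tetrahedra. -/
theorem eq_of_mem_interior_hull {K K' : Finset E3} (hK : K ∈ cells T) (hK' : K' ∈ cells T)
    {x : E3} (hx : x ∈ interior (hull K)) (hx' : x ∈ hull K') : K = K' := by
  classical
  have htet := isTetrahedron_of_mem_cells hK
  have hrange : Set.range htet.basis = (K : Set E3) := Subtype.range_coe
  rw [hull, ← hrange, htet.basis.interior_convexHull] at hx
  have hmem := mem_hull_inter hK hK' (interior_subset (s := hull K) (by
    rw [hull, ← hrange, htet.basis.interior_convexHull]; exact hx)) hx'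
  obtain ⟨w, -, hw, rfl⟩ := mem_hull_iff.1 hmem
  have hsub : K ⊆ K' := fun a ha => by
    by_contra ha'
    have h1 := hx ⟨a, ha⟩
    rw [← htet.bary_coord, affineMap_sum_smul _ hw, Finset.sum_eq_zero] at h1
    · exact lt_irrefl _ h1
    · intro c hc
      obtain ⟨hcK, hcK'⟩ := Finset.mem_inter.1 hc
      rw [htet.bary.coord_ne a ha c hcK (fun h => ha' (h ▸ hcK')), mul_zero]
  exact Finset.eq_of_subset_of_card_le hsub (by rw [hK.2, hK'.2])

end Conformity


/-! ### Weak derivatives of continuous piecewise polynomials -/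

open Filter Topology in
/-- A continuous selection of finitely many Lipschitz functions is Lipschitz. -/
theorem lipschitzWith_of_selection {ι E : Type*} [Finite ι] [NormedAddCommGroup E]
    [NormedSpace ℝ E] {f : E → ℝ} (hf : Continuous f) {F : ι → E → ℝ} {c : NNReal}
    (hF : ∀ i, LipschitzWith c (F i)) (h : ∀ x, ∃ i, f x = F i x) : LipschitzWith c f := by
  refine LipschitzWith.of_dist_le_mul fun y x => ?_
  set γ : ℝ → E := fun t => AffineMap.lineMap x y t with hγ
  have hγc : Continuous γ := AffineMap.lineMap_continuous
  have hFγ : ∀ i t t', |F i (γ t') - F i (γ t)| ≤ c * dist y x * |t' - t| := fun i t t' => by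
    have := (hF i).dist_le_mul (γ t') (γ t)
    rw [Real.dist_eq, hγ, dist_lineMap_lineMap, Real.dist_eq, dist_comm x y] at this
    linarith
  set S := {t : ℝ | |f (γ t) - f (γ 0)| ≤ c * dist y x * t} with hS
  have hclosed : IsClosed S := by
    refine isClosed_le ?_ (by fun_prop)
    have := hf.comp hγc
    fun_prop
  have hsub : Set.Icc (0 : ℝ) 1 ⊆ S := by
    refine IsClosed.Icc_subset_of_forall_exists_gt (hclosed.inter isClosed_Icc) (by simp [hS])
      fun t ht z hz => ?_
    -- near `t`, only those functions that attain the value of `f` at `t` are selected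
    have hev : ∀ᶠ t' in 𝓝 t, ∀ i, F i (γ t) ≠ f (γ t) → F i (γ t') ≠ f (γ t') := by
      rw [eventually_all]
      intro i
      by_cases hi : F i (γ t) = f (γ t)
      · simp [hi]
      · have h1 : ContinuousAt (fun t' => F i (γ t') - f (γ t')) t :=
          (((hF i).continuous.comp hγc).sub (hf.comp hγc)).continuousAt
        filter_upwards [h1.eventually_ne (sub_ne_zero.2 hi)] with t' ht' _
        exact sub_ne_zero.1 ht'
    have hev' : ∀ᶠ t' in 𝓝[>] t, (∀ i, F i (γ t) ≠ f (γ t) → F i (γ t') ≠ f (γ t')) ∧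
        t' ∈ Set.Ioc t z :=
      (hev.filter_mono nhdsWithin_le_nhds).and (Ioc_mem_nhdsGT hz)
    obtain ⟨t', h1, h2⟩ := hev'.exists
    refine ⟨t', ?_, h2⟩
    obtain ⟨i, hi⟩ := h (γ t')
    have hi' : F i (γ t) = f (γ t) := by
      by_contra hne
      exact h1 i hne hi.symm
    have h3 := hFγ i t t'
    rw [← hi, hi', abs_of_pos (sub_pos.2 h2.1)] at h3
    have h4 : |f (γ t) - f (γ 0)| ≤ c * dist y x * t := ht.1
    calc |f (γ t') - f (γ 0)| ≤ |f (γ t') - f (γ t)| + |f (γ t) - f (γ 0)| := abs_sub_le _ _ _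
      _ ≤ c * dist y x * t' := by linarith
  have := hsub (Set.right_mem_Icc.2 zero_le_one)
  simpa [hS, hγ, Real.dist_eq] using this

/-- The integral of a directional derivative of a Lipschitz function with compact support
vanishes. -/
theorem integral_lineDeriv_eq_zero {w : E3 → ℝ} {c : NNReal} (hw : LipschitzWith c w)
    (hc : HasCompactSupport w) (n : E3) : ∫ x, lineDeriv ℝ w x n = 0 := by
  have := (LipschitzWith.const (α := E3) (1 : ℝ)).integral_lineDeriv_mul_eq (μ := volume) hw hc (-n)
  simpa [lineDeriv] using this.symm

theorem exists_lipschitzWith_of_finite {ι : Type*} [Finite ι] {F : ι → E3 → ℝ}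
    (h : ∀ i, ∃ c, LipschitzWith c (F i)) : ∃ c, ∀ i, LipschitzWith c (F i) := by
  choose c hc using h
  obtain ⟨M, hM⟩ := (Set.finite_range c).bddAbove
  exact ⟨M, fun i => (hc i).weaken (hM ⟨i, rfl⟩)⟩

/-- The function that coincides with `F K` in the interior of each simplex `K` of a finite
collection, and is zero elsewhere. -/
def piecewise (C : Finset (Finset E3)) (F : Finset E3 → E3 → ℝ) (x : E3) : ℝ :=
  ∑ K ∈ C, (interior (hull K)).indicator (F K) x

theorem memLp_piecewise (C : Finset (Finset E3)) {F : Finset E3 → E3 → ℝ}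
    (hF : ∀ K ∈ C, Continuous (F K)) (r : ENNReal) (Ω : Set E3) :
    MemLp (piecewise C F) r (volume.restrict Ω) := by
  refine memLp_finsetSum _ fun K hK => MemLp.restrict _ ?_
  rw [memLp_indicator_iff_restrict isOpen_interior.measurableSet]
  have hfin : volume (interior (hull K)) < ⊤ :=
    (measure_mono interior_subset).trans_lt (isCompact_hull K).measure_lt_top
  have : IsFiniteMeasure (volume.restrict (interior (hull K))) := ⟨by simpa using hfin⟩
  obtain ⟨M, hM⟩ := (isCompact_hull K).exists_bound_of_continuousOn (hF K hK).continuousOn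
  exact MemLp.of_bound (hF K hK).aestronglyMeasurable M
    (ae_restrict_of_forall_mem isOpen_interior.measurableSet fun x hx => hM x (interior_subset hx))

theorem piecewise_mul (C : Finset (Finset E3)) (F : Finset E3 → E3 → ℝ) (g : E3 → ℝ) (x : E3) :
    piecewise C F x * g x = piecewise C (fun K x => F K x * g x) x := by
  rw [piecewise, piecewise, Finset.sum_mul]
  refine Finset.sum_congr rfl fun K _ => ?_
  by_cases hx : x ∈ interior (hull K) <;> simp [hx]

theorem HasWeakPartial.congr {Ω : Set E3} {j : Fin 3} {u u' g : E3 → ℝ}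
    (h : HasWeakPartial Ω j u g) (hu : ∀ᵐ x ∂volume.restrict Ω, u' x = u x) :
    HasWeakPartial Ω j u' g := fun φ h1 h2 h3 => by
  rw [← h φ h1 h2 h3]
  refine integral_congr_ae ?_
  filter_upwards [hu] with x hx
  rw [hx]

theorem hasDerivAt_ev (x n : E3) (p : Poly) :
    HasDerivAt (fun t : ℝ => ev (x + t • n) p) (ev x (dirDeriv n p)) 0 := by
  induction p using MvPolynomial.induction_on with
  | C c => simpa [ev, dirDeriv_C] using hasDerivAt_const (0 : ℝ) c
  | add p q hp hq =>
    simp only [dirDeriv_add, ev_add]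
    exact hp.add hq
  | mul_X p i hp =>
    have h1 : HasDerivAt (fun t : ℝ => ev (x + t • n) (X i)) (n i) 0 := by
      have := ((hasDerivAt_id (0 : ℝ)).mul_const (n i)).const_add (x i)
      simpa [ev] using this
    simp only [ev_mul]
    refine (hp.fun_mul h1).congr_deriv ?_
    simp [dirDeriv_mul, dirDeriv_X, ev]

theorem contDiff_ev (p : Poly) : ContDiff ℝ ∞ fun x : E3 => ev x p := by
  induction p using MvPolynomial.induction_on with
  | C c => simpa [ev] using contDiff_const
  | add p q hp hq =>
    simp only [ev_add]
    exact hp.add hq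
  | mul_X p i hp =>
    simp only [ev_mul]
    refine hp.mul ?_
    simp only [ev, eval_X]
    exact contDiff_piLp_apply (p := 2)

theorem dirDeriv_single (j : Fin 3) (p : Poly) :
    dirDeriv (EuclideanSpace.single j 1) p = pderiv j p := by
  simp [dirDeriv]

section Grid

variable {T : Geometry.SimplicialComplex ℝ E3} {Ω : Set E3} {C : Finset (Finset E3)}

theorem IsTetGrid.exists_mem_hull (hT : IsTetGrid T Ω) {x : E3} (hx : x ∈ Ω) :
    ∃ K ∈ cells T, x ∈ hull K := by
  have h1 : x ∈ T.space := hT.space_eq ▸ subset_closure hx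
  obtain ⟨s, hs, hxs⟩ := Geometry.SimplicialComplex.mem_space_iff.1 h1
  obtain ⟨K, hK, hsK, hc⟩ := hT.pure s hs
  exact ⟨K, ⟨hK, hc⟩, convexHull_mono (by exact_mod_cast hsK) hxs⟩

theorem piecewise_eq (hC : ∀ K, K ∈ C ↔ K ∈ cells T) (F : Finset E3 → E3 → ℝ) {K : Finset E3}
    (hK : K ∈ cells T) {x : E3} (hx : x ∈ interior (hull K)) : piecewise C F x = F K x := by
  rw [piecewise, Finset.sum_eq_single_of_mem K ((hC K).2 hK), Set.indicator_of_mem hx]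
  intro K' hK' hne
  refine Set.indicator_of_notMem (fun hx' => hne ?_) _
  exact (eq_of_mem_interior_hull hK ((hC K').1 hK') hx (interior_subset hx')).symm

theorem ae_notMem_frontier_hull (C : Finset (Finset E3)) :
    ∀ᵐ x : E3, ∀ K ∈ C, x ∉ frontier (hull K) := by
  rw [Filter.eventually_all_finset]
  intro K _
  exact measure_eq_zero_iff_ae_notMem.1 ((convex_convexHull ℝ _).addHaar_frontier volume)

/-- A piecewise polynomial whose pieces agree on common points of the tetrahedra is weakly
differentiable, and its weak derivatives are the piecewise derivatives. For a test function `φ`,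
the product of `φ` and the piecewise polynomial is continuous, hence Lipschitz, with compact
support, so that its derivative has integral zero. -/
theorem hasWeakPartial_piecewise (hΩo : IsOpen Ω) (hT : IsTetGrid T Ω) (hC : ∀ K, K ∈ C ↔ K ∈ cells T)
    {q : Finset E3 → Poly} (hq : ∀ K ∈ cells T, ∀ K' ∈ cells T, ∀ x ∈ hull K, x ∈ hull K' →
      ev x (q K) = ev x (q K')) (j : Fin 3) :
    HasWeakPartial Ω j (piecewise C fun K x => ev x (q K))
      (piecewise C fun K x => ev x (pderiv j (q K))) := by
  classical
  intro φ hφ hφc hφΩ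
  have hΩ : ∀ x ∉ Ω, φ x = 0 := fun x hx => image_eq_zero_of_notMem_tsupport fun h => hx (hφΩ h)
  obtain ⟨u, hu⟩ : ∃ u : E3 → ℝ, ∀ K ∈ cells T, ∀ x ∈ hull K, u x = ev x (q K) := by
    refine ⟨fun x => if h : ∃ K ∈ cells T, x ∈ hull K then ev x (q h.choose) else 0,
      fun K hK x hx => ?_⟩
    have h : ∃ K ∈ cells T, x ∈ hull K := ⟨K, hK, hx⟩
    simp only [dif_pos h]
    exact hq _ h.choose_spec.1 _ hK x h.choose_spec.2 hx
  set w : E3 → ℝ := fun x => φ x * u x with hw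
  -- the pieces of `w`, with `none` for the set where `φ` vanishes, which contains `Ωᶜ`
  let F : Option C → E3 → ℝ := fun o => o.elim 0 fun K x => φ x * ev x (q K)
  let A : Option C → Set E3 := fun o => o.elim {x | φ x = 0} fun K => hull K
  have hwA : ∀ o, ∀ x ∈ A o, w x = F o x := by
    rintro (_ | K) x hx
    · have : φ x = 0 := hx
      simp [hw, F, this]
    · simp only [hw, F, Option.elim, hu K ((hC K).1 K.2) x hx]
  have hcov : ∀ x, ∃ o, x ∈ A o := fun x => by
    by_cases hx : x ∈ Ω
    · obtain ⟨K, hK, hxK⟩ := hT.exists_mem_hull hx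
      exact ⟨some ⟨K, (hC K).2 hK⟩, hxK⟩
    · exact ⟨none, hΩ x hx⟩
  have hF : ∀ o, ContDiff ℝ ∞ (F o) ∧ HasCompactSupport (F o) := by
    rintro (_ | K)
    · exact ⟨contDiff_const, HasCompactSupport.zero⟩
    · exact ⟨hφ.mul (contDiff_ev _), hφc.mul_right⟩
  have hwc : Continuous w := by
    refine (locallyFinite_of_finite A).continuous (Set.iUnion_eq_univ_iff.2 hcov) ?_ fun o =>
      (hF o).1.continuous.continuousOn.congr (hwA o)
    rintro (_ | K)
    · exact isClosed_eq hφ.continuous continuous_const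
    · exact (isCompact_hull K).isClosed
  obtain ⟨c, hFc⟩ := exists_lipschitzWith_of_finite fun o =>
    ContDiff.lipschitzWith_of_hasCompactSupport (hF o).2 (hF o).1 (by simp)
  have hwl : LipschitzWith c w := lipschitzWith_of_selection hwc hFc fun x =>
    let ⟨o, ho⟩ := hcov x
    ⟨o, hwA o x ho⟩
  have h0 := integral_lineDeriv_eq_zero hwl hφc.mul_right (EuclideanSpace.single j 1)
  set D : E3 → ℝ := fun x => fderiv ℝ φ x (EuclideanSpace.single j 1) with hD
  have hDc : Continuous D := (hφ.continuous_fderiv (by simp)).clm_apply continuous_const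
  set P := piecewise C fun K x => ev x (q K)
  set Q := piecewise C fun K x => ev x (pderiv j (q K))
  -- almost every point of `Ω` is interior to a tetrahedron, where the product rule applies
  have hae : ∀ᵐ x : E3, lineDeriv ℝ w x (EuclideanSpace.single j 1) =
      Ω.indicator (fun x => P x * D x + Q x * φ x) x := by
    filter_upwards [ae_notMem_frontier_hull C] with x hx
    by_cases hxΩ : x ∈ Ω
    · obtain ⟨K, hK, hxK⟩ := hT.exists_mem_hull hxΩ
      have hxi : x ∈ interior (hull K) := by
        by_contra hni
        exact hx K ((hC K).2 hK) ⟨subset_closure hxK, hni⟩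
      have hP : P x = ev x (q K) := piecewise_eq hC _ hK hxi
      have hQ : Q x = ev x (pderiv j (q K)) := piecewise_eq hC _ hK hxi
      rw [Set.indicator_of_mem hxΩ, hP, hQ]
      have hev : w =ᶠ[nhds x] fun y => φ y * ev y (q K) := by
        filter_upwards [isOpen_interior.mem_nhds hxi] with y hy
        simp only [hw, hu K hK y (interior_subset hy)]
      rw [hev.lineDeriv_eq]
      refine HasLineDerivAt.lineDeriv ?_
      have h1 : HasDerivAt (fun t : ℝ => φ (x + t • EuclideanSpace.single j 1)) (D x) 0 :=
        ((hφ.differentiable (by simp)) x).hasFDerivAt.hasLineDerivAt _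
      have h2 := h1.fun_mul (hasDerivAt_ev x (EuclideanSpace.single j 1) (q K))
      refine h2.congr_deriv ?_
      rw [dirDeriv_single, zero_smul, add_zero]
      ring
    · rw [Set.indicator_of_notMem hxΩ]
      have hev : w =ᶠ[nhds x] fun _ => 0 := by
        have : x ∉ tsupport φ := fun h => hxΩ (hφΩ h)
        filter_upwards [(isClosed_tsupport φ).isOpen_compl.mem_nhds this] with y hy
        rw [hw]
        simp [image_eq_zero_of_notMem_tsupport hy]
      rw [hev.lineDeriv_eq]
      simp [lineDeriv]
  have hint : ∀ (r : Finset E3 → Poly) (g : E3 → ℝ), Continuous g →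
      Integrable (fun x => piecewise C (fun K x => ev x (r K)) x * g x) (volume.restrict Ω) :=
    fun r g hg => by
      simp only [piecewise_mul]
      exact memLp_one_iff_integrable.1
        (memLp_piecewise C (fun K _ => (continuous_ev (r K)).mul hg) 1 Ω)
  rw [integral_congr_ae hae, integral_indicator hΩo.measurableSet,
    integral_add (hint _ D hDc) (hint _ φ hφ.continuous)] at h0
  exact eq_neg_of_add_eq_zero_left h0

/-- A field that coincides almost everywhere with polynomial fields on the tetrahedra of a grid
belongs to `H¹(div)` if these fields and their divergences agree on common points. -/
theorem memH1Div_of_ae_eq (hΩo : IsOpen Ω) (hT : IsTetGrid T Ω) {p : Finset E3 → VecPoly}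
    (hp : ∀ K ∈ cells T, ∀ K' ∈ cells T, ∀ x ∈ hull K, x ∈ hull K' →
      (∀ i, ev x (p K i) = ev x (p K' i)) ∧ ev x (divP (p K)) = ev x (divP (p K')))
    {v : E3 → E3}
    (hv : ∀ K ∈ cells T, ∀ᵐ x ∂volume.restrict (hull K), ∀ i, v x i = ev x (p K i)) :
    MemH1Div Ω v := by
  have hfin : (cells T).Finite := hT.finite.subset fun K hK => hK.1
  set C := hfin.toFinset
  have hC : ∀ K, K ∈ C ↔ K ∈ cells T := fun K => hfin.mem_toFinset
  have hmem : ∀ r : Finset E3 → Poly,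
      MemLp (piecewise C fun K x => ev x (r K)) 2 (volume.restrict Ω) := fun r =>
    memLp_piecewise C (fun K _ => continuous_ev (r K)) 2 Ω
  have hae : ∀ i, ∀ᵐ x ∂volume.restrict Ω,
      v x i = piecewise C (fun K x => ev x (p K i)) x := fun i => by
    have hv' : ∀ᵐ x : E3, ∀ K ∈ C, x ∈ hull K → ∀ i, v x i = ev x (p K i) := by
      rw [Filter.eventually_all_finset]
      exact fun K hK => (ae_restrict_iff' (isCompact_hull K).measurableSet).1 (hv K ((hC K).1 hK))
    rw [ae_restrict_iff' hΩo.measurableSet]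
    filter_upwards [ae_notMem_frontier_hull C, hv'] with x hx hvx hxΩ
    obtain ⟨K, hK, hxK⟩ := hT.exists_mem_hull hxΩ
    have hxi : x ∈ interior (hull K) := by
      by_contra hni
      exact hx K ((hC K).2 hK) ⟨subset_closure hxK, hni⟩
    rw [piecewise_eq hC _ hK hxi, hvx K ((hC K).2 hK) hxK]
  have hdiv : (fun x => ∑ i, piecewise C (fun K x => ev x (pderiv i (p K i))) x) =
      piecewise C fun K x => ev x (divP (p K)) := by
    ext x
    simp only [piecewise, ev_divP]
    rw [Finset.sum_comm]
    refine Finset.sum_congr rfl fun K _ => ?_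
    by_cases hx : x ∈ interior (hull K) <;> simp [hx]
  refine ⟨fun i => (hmem fun K => p K i).congr_norm ?_ ?_,
    fun i j => piecewise C fun K x => ev x (pderiv j (p K i)), fun i j => ⟨hmem _, ?_⟩, ?_⟩
  · exact (hmem fun K => p K i).aestronglyMeasurable.congr
      ((hae i).mono fun x hx => hx.symm)
  · filter_upwards [hae i] with x hx
    rw [hx]
  · exact (hasWeakPartial_piecewise hΩo hT hC (fun K hK K' hK' x hx hx' =>
      (hp K hK K' hK' x hx hx').1 i) j).congr (hae i)
  · rw [hdiv]
    exact ⟨hmem _, fun j => ⟨_, hmem _, hasWeakPartial_piecewise hΩo hT hC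
      (fun K hK K' hK' x hx hx' => (hp K hK K' hK' x hx hx').2) j⟩⟩

end Grid

end TetElement

end

theorem mainTheorem10 (k : ℕ) (hk : 4 ≤ k) :
    (∀ (K : Finset TetElement.E3) (hK : TetElement.IsTetrahedron K)
      (frame : Finset TetElement.E3 → TetElement.EdgeFrame),
      (∀ e ∈ K.powersetCard 2, (frame e).IsAdapted e) →
      ∀ D : TetElement.DofData k hK,
        ∃! v : TetElement.VecPoly,
          v ∈ TetElement.vecPolyLE ((k : ℤ) + 2) ∧ TetElement.HasDofs k hK frame v D) ∧
    (∀ (Ω : Set TetElement.E3) (T : Geometry.SimplicialComplex ℝ TetElement.E3)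
      (frame : Finset TetElement.E3 → TetElement.EdgeFrame),
      IsOpen Ω → TetElement.IsTetGrid T Ω →
      (∀ e ∈ T.faces, e.card = 2 → (frame e).IsAdapted e) →
      (∀ p : Finset TetElement.E3 → TetElement.VecPoly, TetElement.IsSingleValued k T frame p →
        ∀ K ∈ TetElement.cells T, ∀ K' ∈ TetElement.cells T,
          ∀ x ∈ TetElement.hull K ∩ TetElement.hull K',
            (∀ i, TetElement.ev x (p K i) = TetElement.ev x (p K' i)) ∧
            TetElement.ev x (TetElement.divP (p K)) =
              TetElement.ev x (TetElement.divP (p K'))) ∧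
      ∀ v ∈ TetElement.globalSpace k T frame, TetElement.MemH1Div Ω v) := by
  refine ⟨fun K hK frame hframe D => TetElement.existsUnique_hasDofs hk hK hframe D,
    fun Ω T frame hΩ hT hframe => ⟨fun p hp K hK K' hK' x hx =>
      TetElement.ev_eq_of_isSingleValued hframe hp hK hK' hx.1 hx.2, ?_⟩⟩
  rintro v ⟨p, hp, hv⟩
  exact TetElement.memH1Div_of_ae_eq hΩ hT (fun K hK K' hK' x hx hx' =>
    TetElement.ev_eq_of_isSingleValued hframe hp hK hK' hx hx') hv
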